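/- **Notation.** Let $T\in\mathbb R^{d_1\times d_2\times d_3}$ and $d=d_1+d_2+d_3$. Let $\mathcal L_j(T)\subseteq\mathbb R^{d_j}$ be the span of the mode-$j$ fibers of $T$, $r_j$ its dimension, and $$\bar r(T)=\sqrt{(r_1r_2d_3+r_1r_3d_2+r_2r_3d_1)/d}.$$ The coherence of a subspace $U\subseteq\mathbb R^{k}$ is $\mu(U)=\frac{k}{\dim U}\max_i\|P_Ue_i\|^2$, and $\mu(T)=\max_j\mu(\mathcal L_j(T))$. Let $P^j$ and $P^j_\perp$ be the orthogonal projections of $\mathbb R^{d_j}$ onto $\mathcal L_j(T)$ and $\mathcal L_j(T)^\perp$, and let $$Q_T=P^1\otimes P^2\otimes P^3+P^1_\perp\otimes P^2\otimes P^3+P^1\otimes P^2_\perp\otimes P^3+P^1\otimes P^2\otimes P^3_\perp .$$ For $(a,b,c)\in[d_1]\times[d_2]\times[d_3]$ let $P_{(a,b,c)}$ be the linear map on tensors that keeps the $(a,b,c)$ entry and sets all others to $0$. Let $(a_i,b_i,c_i)$, $1\le i\le n$, be independent and uniformly distributed on $[d_1]\times[d_2]\times[d_3]$, let $n_1\ge1$,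 $n_1n_2\le n$, and for $1\le k\le n_2$ let $$R_k=I-\frac1{n_1}\sum_{i=(k-1)n_1+1}^{kn_1}(d_1d_2d_3)\,P_{(a_i,b_i,c_i)} .$$ Write $\|\cdot\|_{\max}$ for the largest absolute value of an entry, and $\|\cdot\|$ for the operator norm of a linear map on tensors with respect to the Hilbert-Schmidt norm. **Lemma 6.** Assume that $\mu(T)\le\mu_0$ and $\bar r(T)=r$. Then for every fixed $k\in\{1,\dots,n_2\}$ and all $\tau>0$, $$\mathbb P\{\|Q_TR_kQ_T\|\ge\tau\}\le 2r^2d\,\exp\Big(-\frac{\tau^2/2}{1+2\tau/3}\cdot\frac{n_1}{\mu_0^2r^2d}\Big),$$ and for every fixed tensor $X$ with $\|X\|_{\max}=1$, $$\mathbb P\{\|Q_TR_kX\|_{\max}\ge\tau\}\le 2d_1d_2d_3\exp\Big(-\frac{\tau^2/2}{1+2\tau/3}\cdot\frac{n_1}{\mu_0^2r^2d}\Big).$$ In particular, for every fixed $X$ with $\|X\|_{\max}=1$ and $X=Q_TX$, the same bound holds for $\mathbb P\{\|Q_TR_kQ_TX\|_{\max}\ge\tau\}$. -/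

import Mathlib

open MeasureTheory ProbabilityTheory

noncomputable section

namespace TensorCompletion

/-- The index set `[d₁] × [d₂] × [d₃]`. -/
abbrev Idx (d₁ d₂ d₃ : ℕ) : Type := Fin d₁ × Fin d₂ × Fin d₃

/-- Real third order tensors of size `d₁ × d₂ × d₃`. The norm and the inner product of this
Euclidean space are the Hilbert-Schmidt norm and the entrywise inner product; the norm of a
continuous linear map between such spaces is the induced operator norm. -/
abbrev Tensor (d₁ d₂ d₃ : ℕ) : Type := EuclideanSpace ℝ (Idx d₁ d₂ d₃)

variable {d₁ d₂ d₃ : ℕ}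

/-- The entrywise maximum norm. -/
def maxNorm (X : Tensor d₁ d₂ d₃) : ℝ := ⨆ w : Idx d₁ d₂ d₃, |X w|

/-- Mode-1 fiber `X(·, b, c)`. -/
def fiber₁ (X : Tensor d₁ d₂ d₃) (b : Fin d₂) (c : Fin d₃) : EuclideanSpace ℝ (Fin d₁) :=
  WithLp.toLp 2 fun a => X (a, b, c)

/-- Mode-2 fiber `X(a, ·, c)`. -/
def fiber₂ (X : Tensor d₁ d₂ d₃) (a : Fin d₁) (c : Fin d₃) : EuclideanSpace ℝ (Fin d₂) :=
  WithLp.toLp 2 fun b => X (a, b, c)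

/-- Mode-3 fiber `X(a, b, ·)`. -/
def fiber₃ (X : Tensor d₁ d₂ d₃) (a : Fin d₁) (b : Fin d₂) : EuclideanSpace ℝ (Fin d₃) :=
  WithLp.toLp 2 fun c => X (a, b, c)

/-- The linear space spanned by the mode-1 fibers. -/
def fiberSpan₁ (X : Tensor d₁ d₂ d₃) : Submodule ℝ (EuclideanSpace ℝ (Fin d₁)) :=
  Submodule.span ℝ (Set.range fun p : Fin d₂ × Fin d₃ => fiber₁ X p.1 p.2)

/-- The linear space spanned by the mode-2 fibers. -/
def fiberSpan₂ (X : Tensor d₁ d₂ d₃) : Submodule ℝ (EuclideanSpace ℝ (Fin d₂)) :=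
  Submodule.span ℝ (Set.range fun p : Fin d₁ × Fin d₃ => fiber₂ X p.1 p.2)

/-- The linear space spanned by the mode-3 fibers. -/
def fiberSpan₃ (X : Tensor d₁ d₂ d₃) : Submodule ℝ (EuclideanSpace ℝ (Fin d₃)) :=
  Submodule.span ℝ (Set.range fun p : Fin d₁ × Fin d₂ => fiber₃ X p.1 p.2)

/-- The rank `√((r₁r₂d₃ + r₁r₃d₂ + r₂r₃d₁) / d)`, where `(r₁, r₂, r₃)` are the Tucker ranks
and `d = d₁ + d₂ + d₃`. -/
def rbar (X : Tensor d₁ d₂ d₃) : ℝ :=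
  Real.sqrt
    (((Module.finrank ℝ (fiberSpan₁ X) : ℝ) * (Module.finrank ℝ (fiberSpan₂ X) : ℝ) * (d₃ : ℝ)
      + (Module.finrank ℝ (fiberSpan₁ X) : ℝ) * (Module.finrank ℝ (fiberSpan₃ X) : ℝ) * (d₂ : ℝ)
      + (Module.finrank ℝ (fiberSpan₂ X) : ℝ) * (Module.finrank ℝ (fiberSpan₃ X) : ℝ) * (d₁ : ℝ))
      / ((d₁ : ℝ) + (d₂ : ℝ) + (d₃ : ℝ)))

/-- Coherence of a linear subspace `U` of `ℝᵏ`: `(k / dim U) * max_i ‖P_U e_i‖²`. -/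
def subspaceCoherence {k : ℕ} (U : Submodule ℝ (EuclideanSpace ℝ (Fin k))) : ℝ :=
  ((k : ℝ) / (Module.finrank ℝ U : ℝ)) *
    ⨆ i : Fin k, ‖U.starProjection (EuclideanSpace.single i (1 : ℝ))‖ ^ 2

/-- Coherence of a tensor. -/
def coherence (X : Tensor d₁ d₂ d₃) : ℝ :=
  max (subspaceCoherence (fiberSpan₁ X))
    (max (subspaceCoherence (fiberSpan₂ X)) (subspaceCoherence (fiberSpan₃ X)))

/-- Marginal multiplication `A ×₁ X`: the map `A` applied to every mode-1 fiber. -/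
def mode₁ (A : EuclideanSpace ℝ (Fin d₁) →L[ℝ] EuclideanSpace ℝ (Fin d₁)) :
    Tensor d₁ d₂ d₃ →L[ℝ] Tensor d₁ d₂ d₃ :=
  LinearMap.toContinuousLinearMap
    { toFun := fun X => WithLp.toLp 2 fun w => A (fiber₁ X w.2.1 w.2.2) w.1
      map_add' := fun X Y => by
        ext w
        have h : fiber₁ (X + Y) w.2.1 w.2.2 = fiber₁ X w.2.1 w.2.2 + fiber₁ Y w.2.1 w.2.2 := rfl
        simp [h]
      map_smul' := fun t X => by
        ext w
        have h : fiber₁ (t • X) w.2.1 w.2.2 = t • fiber₁ X w.2.1 w.2.2 := rfl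
        simp [h] }

/-- Marginal multiplication `A ×₂ X`. -/
def mode₂ (A : EuclideanSpace ℝ (Fin d₂) →L[ℝ] EuclideanSpace ℝ (Fin d₂)) :
    Tensor d₁ d₂ d₃ →L[ℝ] Tensor d₁ d₂ d₃ :=
  LinearMap.toContinuousLinearMap
    { toFun := fun X => WithLp.toLp 2 fun w => A (fiber₂ X w.1 w.2.2) w.2.1
      map_add' := fun X Y => by
        ext w
        have h : fiber₂ (X + Y) w.1 w.2.2 = fiber₂ X w.1 w.2.2 + fiber₂ Y w.1 w.2.2 := rfl
        simp [h]
      map_smul' := fun t X => by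
        ext w
        have h : fiber₂ (t • X) w.1 w.2.2 = t • fiber₂ X w.1 w.2.2 := rfl
        simp [h] }

/-- Marginal multiplication `A ×₃ X`. -/
def mode₃ (A : EuclideanSpace ℝ (Fin d₃) →L[ℝ] EuclideanSpace ℝ (Fin d₃)) :
    Tensor d₁ d₂ d₃ →L[ℝ] Tensor d₁ d₂ d₃ :=
  LinearMap.toContinuousLinearMap
    { toFun := fun X => WithLp.toLp 2 fun w => A (fiber₃ X w.1 w.2.1) w.2.2
      map_add' := fun X Y => by
        ext w
        have h : fiber₃ (X + Y) w.1 w.2.1 = fiber₃ X w.1 w.2.1 + fiber₃ Y w.1 w.2.1 := rfl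
        simp [h]
      map_smul' := fun t X => by
        ext w
        have h : fiber₃ (t • X) w.1 w.2.1 = t • fiber₃ X w.1 w.2.1 := rfl
        simp [h] }

/-- The tensor map `A ⊗ B ⊗ C`, acting on rank-one tensors by
`u ⊗ v ⊗ w ↦ (A u) ⊗ (B v) ⊗ (C w)`. -/
def tensorMap (A : EuclideanSpace ℝ (Fin d₁) →L[ℝ] EuclideanSpace ℝ (Fin d₁))
    (B : EuclideanSpace ℝ (Fin d₂) →L[ℝ] EuclideanSpace ℝ (Fin d₂))
    (C : EuclideanSpace ℝ (Fin d₃) →L[ℝ] EuclideanSpace ℝ (Fin d₃)) :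
    Tensor d₁ d₂ d₃ →L[ℝ] Tensor d₁ d₂ d₃ :=
  mode₁ A ∘L mode₂ B ∘L mode₃ C

/-- The rank-one tensor `u ⊗ v ⊗ w`. -/
def outer (u : EuclideanSpace ℝ (Fin d₁)) (v : EuclideanSpace ℝ (Fin d₂))
    (w : EuclideanSpace ℝ (Fin d₃)) : Tensor d₁ d₂ d₃ :=
  WithLp.toLp 2 fun x => u x.1 * v x.2.1 * w x.2.2

/-- `tensorMap` acts on rank-one tensors factor by factor. -/
theorem tensorMap_outer (A : EuclideanSpace ℝ (Fin d₁) →L[ℝ] EuclideanSpace ℝ (Fin d₁))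
    (B : EuclideanSpace ℝ (Fin d₂) →L[ℝ] EuclideanSpace ℝ (Fin d₂))
    (C : EuclideanSpace ℝ (Fin d₃) →L[ℝ] EuclideanSpace ℝ (Fin d₃))
    (u : EuclideanSpace ℝ (Fin d₁)) (v : EuclideanSpace ℝ (Fin d₂))
    (w : EuclideanSpace ℝ (Fin d₃)) :
    tensorMap A B C (outer u v w) = outer (A u) (B v) (C w) := by
  have h3 : mode₃ C (outer u v w) = outer u v (C w) := by
    ext x
    have h : fiber₃ (outer u v w) x.1 x.2.1 = (u x.1 * v x.2.1) • w := by
      ext c; simp [fiber₃, outer]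
    change C (fiber₃ (outer u v w) x.1 x.2.1) x.2.2 = _
    rw [h]; simp [outer]
  have h2 : mode₂ B (outer u v (C w)) = outer u (B v) (C w) := by
    ext x
    have h : fiber₂ (outer u v (C w)) x.1 x.2.2 = (u x.1 * C w x.2.2) • v := by
      ext c; simp [fiber₂, outer]; ring
    change B (fiber₂ (outer u v (C w)) x.1 x.2.2) x.2.1 = _
    rw [h]; simp [outer]; ring
  have h1 : mode₁ A (outer u (B v) (C w)) = outer (A u) (B v) (C w) := by
    ext x
    have h : fiber₁ (outer u (B v) (C w)) x.2.1 x.2.2 = (B v x.2.1 * C w x.2.2) • u := by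
      ext c; simp [fiber₁, outer]; ring
    change A (fiber₁ (outer u (B v) (C w)) x.2.1 x.2.2) x.1 = _
    rw [h]; simp [outer]; ring
  simp [tensorMap, h1, h2, h3]

/-- The projection `Q_X = Q_X⁰ + Q_X¹ + Q_X² + Q_X³`, with `Q_X⁰ = P¹ ⊗ P² ⊗ P³`, and `Q_Xʲ`
obtained from `Q_X⁰` by replacing `Pʲ` with the projection onto the orthogonal complement. -/
def QProj (X : Tensor d₁ d₂ d₃) : Tensor d₁ d₂ d₃ →L[ℝ] Tensor d₁ d₂ d₃ :=
  tensorMap (fiberSpan₁ X).starProjection (fiberSpan₂ X).starProjection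
      (fiberSpan₃ X).starProjection
    + tensorMap (fiberSpan₁ X)ᗮ.starProjection (fiberSpan₂ X).starProjection
      (fiberSpan₃ X).starProjection
    + tensorMap (fiberSpan₁ X).starProjection (fiberSpan₂ X)ᗮ.starProjection
      (fiberSpan₃ X).starProjection
    + tensorMap (fiberSpan₁ X).starProjection (fiberSpan₂ X).starProjection
      (fiberSpan₃ X)ᗮ.starProjection

/-- The operator `P_{(a,b,c)}`, which keeps the entry at `(a, b, c)` and sets all others to `0`. -/
def entryProj (w : Idx d₁ d₂ d₃) : Tensor d₁ d₂ d₃ →L[ℝ] Tensor d₁ d₂ d₃ :=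
  LinearMap.toContinuousLinearMap
    { toFun := fun X => EuclideanSpace.single w (X w)
      map_add' := fun X Y => by
        ext v
        by_cases h : v = w <;> simp [h]
      map_smul' := fun t X => by
        ext v
        by_cases h : v = w <;> simp [h] }

/-- The random variables `s 0, …, s (n - 1)` are independent and uniformly distributed on
`[d₁] × [d₂] × [d₃]`. -/
def IIDUniform {Ω : Type*} [MeasurableSpace Ω] (P : Measure Ω) {n : ℕ}
    (s : Fin n → Ω → Idx d₁ d₂ d₃) : Prop :=
  (∀ i, Measurable (s i)) ∧ iIndepFun s P ∧
    ∀ i, Measure.map (s i) P = uniformOn (Set.univ : Set (Idx d₁ d₂ d₃))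

/-- The positions `i` (counted from `0`) of the `k`-th block of length `n₁`, `k = 1, 2, …`. -/
def block (n n₁ k : ℕ) : Finset (Fin n) :=
  Finset.univ.filter fun i => (k - 1) * n₁ ≤ (i : ℕ) ∧ (i : ℕ) < k * n₁

/-- The operator `R_k = I - (1/n₁) ∑_{i in block k} (d₁ d₂ d₃) P_{(aᵢ,bᵢ,cᵢ)}` of a sample `x`. -/
def RBlock {n : ℕ} (x : Fin n → Idx d₁ d₂ d₃) (n₁ k : ℕ) :
    Tensor d₁ d₂ d₃ →L[ℝ] Tensor d₁ d₂ d₃ :=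
  ContinuousLinearMap.id ℝ (Tensor d₁ d₂ d₃)
    - (1 / (n₁ : ℝ)) •
      ∑ i ∈ block n n₁ k, ((d₁ : ℝ) * (d₂ : ℝ) * (d₃ : ℝ)) • entryProj (x i)

end TensorCompletion

end

open TensorCompletion

/-! Both tails are Bernstein bounds for averages of `n₁` independent centred terms, governed by the
same constant. Put N = d₁d₂d₃ and M = μ₀²r²d, let e_w be the unit tensors, and let p_j be the
squared length of the projection onto L_j(T) of the mode-j factor of e_w. Then ‖Q_T e_w‖² = p₁p₂ +
p₁p₃ + p₂p₃ - 2p₁p₂p₃. Summing over w gives rank Q_T ≤ r²d (`opTrace_QProj_le`), and the coherence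
bound p_j ≤ μ₀r_j/d_j gives N‖Q_T e_w‖² ≤ M (`mul_sq_norm_QProj_single_le`).

For the operator norm, restrict to the range K of Q_T. The vectors f_w = Q_T e_w form a Parseval
frame of K, and the compression of R_k is an average of terms I - N f_w ⊗ f_w, which are centred,
with norm at most 2M and variance at most M. The operator Bernstein inequality on K costs the factor
2 dim K ≤ 2r²d. For the max norm, each entry of Q_T R_k X is a scalar average with the same
constants, and a union bound over the N entries finishes.

Operator Bernstein follows Ahlswede and Winter: the Golden-Thompson inequality peels one summand at
a time off the trace of the exponential, independence averages it, and Markov's inequality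
concludes. Golden-Thompson itself is the limit, by the Lie-Trotter formula, of a trace inequality
for powers of two. -/

/-! ### Traces of operators and of their powers -/

section OperatorTrace

variable {E : Type*} [NormedAddCommGroup E] [InnerProductSpace ℝ E]

/-- The trace of a continuous linear endomorphism of a finite-dimensional space. -/
noncomputable def opTrace : (E →L[ℝ] E) →ₗ[ℝ] ℝ :=
  (LinearMap.trace ℝ E).comp (ContinuousLinearMap.coeLM ℝ)

theorem opTrace_eq_sum_inner {ι : Type*} [Fintype ι] (b : OrthonormalBasis ι ℝ E)
    (A : E →L[ℝ] E) : opTrace A = ∑ i, inner ℝ (b i) (A (b i)) :=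
  LinearMap.trace_eq_sum_inner _ b

theorem opTrace_mul_comm (A B : E →L[ℝ] E) : opTrace (A * B) = opTrace (B * A) :=
  LinearMap.trace_mul_comm ℝ (A : E →ₗ[ℝ] E) (B : E →ₗ[ℝ] E)

/-- Cyclicity of the trace on powers. -/
theorem opTrace_mul_pow_comm (A B : E →L[ℝ] E) (m : ℕ) :
    opTrace ((A * B) ^ m) = opTrace ((B * A) ^ m) := by
  cases m with
  | zero => simp
  | succ m =>
    have h : ∀ m : ℕ, (A * B) ^ m * A = A * (B * A) ^ m := by
      intro m
      induction m with
      | zero => simp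
      | succ m ih => rw [pow_succ', mul_assoc, ih, pow_succ']; simp only [mul_assoc]
    rw [pow_succ, ← mul_assoc, h, mul_assoc, opTrace_mul_comm, mul_assoc, opTrace_mul_comm,
      ← pow_succ', pow_succ]

variable [FiniteDimensional ℝ E]

theorem opTrace_one : opTrace (1 : E →L[ℝ] E) = Module.finrank ℝ E :=
  LinearMap.trace_one ℝ E

theorem continuous_opTrace : Continuous (opTrace : (E →L[ℝ] E) → ℝ) :=
  LinearMap.continuous_of_finiteDimensional _

theorem opTrace_star_mul {ι : Type*} [Fintype ι] (b : OrthonormalBasis ι ℝ E)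
    (A B : E →L[ℝ] E) : opTrace (star A * B) = ∑ i, inner ℝ (A (b i)) (B (b i)) := by
  rw [opTrace_eq_sum_inner b]
  refine Finset.sum_congr rfl fun i _ => ?_
  rw [ContinuousLinearMap.star_eq_adjoint]
  exact ContinuousLinearMap.adjoint_inner_right A (b i) (B (b i))

theorem opTrace_star_mul_self_nonneg (A : E →L[ℝ] E) : 0 ≤ opTrace (star A * A) := by
  rw [opTrace_star_mul (stdOrthonormalBasis ℝ E)]
  exact Finset.sum_nonneg fun i _ => real_inner_self_nonneg

/-- The Cauchy-Schwarz inequality for the Hilbert-Schmidt inner product. -/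
theorem sq_opTrace_star_mul_le (A B : E →L[ℝ] E) :
    opTrace (star A * B) ^ 2 ≤ opTrace (star A * A) * opTrace (star B * B) := by
  simp only [opTrace_star_mul (stdOrthonormalBasis ℝ E)]
  set b := stdOrthonormalBasis ℝ E
  calc (∑ i, inner ℝ (A (b i)) (B (b i))) ^ 2
      ≤ (∑ i, ‖A (b i)‖ * ‖B (b i)‖) ^ 2 := by
        rw [sq_le_sq, abs_of_nonneg (a := ∑ i, ‖A (b i)‖ * ‖B (b i)‖)
          (Finset.sum_nonneg fun i _ => by positivity)]
        exact (Finset.abs_sum_le_sum_abs _ _).trans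
          (Finset.sum_le_sum fun i _ => abs_real_inner_le_norm _ _)
    _ ≤ (∑ i, ‖A (b i)‖ ^ 2) * ∑ i, ‖B (b i)‖ ^ 2 := Finset.sum_mul_sq_le_sq_mul_sq _ _ _
    _ = _ := by simp only [real_inner_self_eq_norm_sq]

/-- The two claims feed each other in one induction. For the first, pass from X to X²: cyclicity
turns X*X*XX into (X*X)(XX*), the second claim separates the two factors, and Cauchy-Schwarz
applies, the powers of X*X and XX* having equal traces. For the second, the first claim for AB and
cyclicity lead to A²B², at one exponent lower. Only the second claim is used for Golden-Thompson. -/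
theorem opTrace_pow_pow_two_le (j : ℕ) :
    (∀ X : E →L[ℝ] E, |opTrace (X ^ 2 ^ (j + 1))| ≤ opTrace ((star X * X) ^ 2 ^ j)) ∧
    (∀ A B : E →L[ℝ] E, IsSelfAdjoint A → IsSelfAdjoint B →
      opTrace ((A * B) ^ 2 ^ j) ≤ opTrace (A ^ 2 ^ j * B ^ 2 ^ j)) := by
  induction j with
  | zero =>
    refine ⟨fun X => ?_, fun A B _ _ => by simp⟩
    have h := sq_opTrace_star_mul_le (star X) X
    rw [star_star, opTrace_mul_comm X (star X), ← sq, ← sq] at h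
    simpa using abs_le_of_sq_le_sq h (opTrace_star_mul_self_nonneg X)
  | succ j ih =>
    obtain ⟨ihL, ihG⟩ := ih
    constructor
    · intro X
      have h1 := ihL (X ^ 2)
      rw [← pow_mul, ← pow_succ'] at h1
      have e : star (X ^ 2) * X ^ 2 = star X * ((star X * X) * X) := by
        simp only [sq, star_mul, mul_assoc]
      rw [e, opTrace_mul_pow_comm, mul_assoc] at h1
      have h2 := ihG (star X * X) (X * star X) (.star_mul_self X) (.mul_star_self X)
      have hA : IsSelfAdjoint ((star X * X) ^ 2 ^ j) := (IsSelfAdjoint.star_mul_self X).pow _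
      have hB : IsSelfAdjoint ((X * star X) ^ 2 ^ j) := (IsSelfAdjoint.mul_star_self X).pow _
      have h3 := sq_opTrace_star_mul_le ((star X * X) ^ 2 ^ j) ((X * star X) ^ 2 ^ j)
      have h4 : 0 ≤ opTrace ((star X * X) ^ 2 ^ (j + 1)) := by
        rw [pow_succ, pow_mul, sq]
        have h := opTrace_star_mul_self_nonneg ((star X * X) ^ 2 ^ j)
        rwa [hA.star_eq] at h
      rw [hA.star_eq, hB.star_eq, ← sq ((star X * X) ^ 2 ^ j), ← sq ((X * star X) ^ 2 ^ j),
        ← pow_mul, ← pow_mul, ← pow_succ, opTrace_mul_pow_comm X, ← sq (opTrace _)] at h3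
      exact h1.trans (h2.trans (le_of_sq_le_sq h3 h4))
    · intro A B hA hB
      have h1 := (le_abs_self _).trans (ihL (A * B))
      have e : star (A * B) * (A * B) = B * (A ^ 2 * B) := by
        rw [star_mul, hA.star_eq, hB.star_eq]; simp only [sq, mul_assoc]
      rw [e, opTrace_mul_pow_comm B (A ^ 2 * B), mul_assoc, ← sq B] at h1
      refine h1.trans ((ihG _ _ (hA.pow 2) (hB.pow 2)).trans (le_of_eq ?_))
      rw [← pow_mul, ← pow_mul, ← pow_succ']

end OperatorTrace

/-! ### The Lie-Trotter product formula -/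

section LieTrotter

open Filter Topology NormedSpace

/-- Telescoping. Asking for ‖1‖ ≤ 1 instead of ‖1‖ = 1 admits the endomorphisms of the zero space.
-/
theorem norm_pow_sub_pow_le_of_norm_le {R : Type*} [NormedRing R] {C : ℝ} (hC : 1 ≤ C)
    (h1 : ‖(1 : R)‖ ≤ 1) {X Y : R} (hX : ‖X‖ ≤ C) (hY : ‖Y‖ ≤ C) (n : ℕ) :
    ‖X ^ n - Y ^ n‖ ≤ n * C ^ n * ‖X - Y‖ := by
  have hpow : ∀ m : ℕ, ‖Y ^ m‖ ≤ C ^ m := by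
    intro m
    induction m with
    | zero => simpa using h1
    | succ m ih =>
      rw [pow_succ, pow_succ]
      exact (norm_mul_le _ _).trans (mul_le_mul ih hY (norm_nonneg _) (by positivity))
  induction n with
  | zero => simp
  | succ n ih =>
    have e : X ^ (n + 1) - Y ^ (n + 1) = X * (X ^ n - Y ^ n) + (X - Y) * Y ^ n := by
      rw [pow_succ', pow_succ']; noncomm_ring
    rw [e]
    calc ‖X * (X ^ n - Y ^ n) + (X - Y) * Y ^ n‖
        ≤ ‖X‖ * ‖X ^ n - Y ^ n‖ + ‖X - Y‖ * ‖Y ^ n‖ :=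
          (norm_add_le _ _).trans (add_le_add (norm_mul_le _ _) (norm_mul_le _ _))
      _ ≤ C * (n * C ^ n * ‖X - Y‖) + ‖X - Y‖ * C ^ (n + 1) := by
          gcongr
          exact (hpow n).trans (pow_le_pow_right₀ hC (Nat.le_succ n))
      _ = ((n + 1 : ℕ) : ℝ) * C ^ (n + 1) * ‖X - Y‖ := by push_cast; ring

variable {R : Type*} [NormedRing R] [NormedAlgebra ℝ R] [CompleteSpace R]

theorem norm_exp_le_exp_norm (h1 : ‖(1 : R)‖ ≤ 1) (x : R) : ‖exp x‖ ≤ Real.exp ‖x‖ := by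
  have hs : HasSum (fun n : ℕ => (n.factorial⁻¹ : ℝ) * ‖x‖ ^ n) (Real.exp ‖x‖) := by
    rw [Real.exp_eq_exp_ℝ]
    exact exp_series_hasSum_exp' (𝕂 := ℝ) ‖x‖
  refine (exp_series_hasSum_exp' (𝕂 := ℝ) x).norm_le_of_bounded hs fun n => ?_
  rw [norm_smul, Real.norm_of_nonneg (by positivity)]
  gcongr
  cases n with
  | zero => simpa using h1
  | succ n => exact norm_pow_le' x n.succ_pos

/-- The Lie-Trotter product formula. -/
theorem tendsto_exp_mul_exp_pow (h1 : ‖(1 : R)‖ ≤ 1) (A B : R) :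
    Tendsto (fun n : ℕ => (exp ((n : ℝ)⁻¹ • A) * exp ((n : ℝ)⁻¹ • B)) ^ n) atTop
      (𝓝 (exp (A + B))) := by
  let _ : NormedAlgebra ℚ R := NormedAlgebra.restrictScalars ℚ ℝ R
  -- Both sides agree to first order at 0, so the difference at t = 1/n is o(1/n). Taking nth powers
  -- multiplies this error by at most n times a constant.
  have hd : HasDerivAt (fun t : ℝ => exp (t • A) * exp (t • B) - exp (t • (A + B))) 0 0 := by
    have h := ((hasDerivAt_exp_smul_const A (0 : ℝ)).mul
      (hasDerivAt_exp_smul_const B (0 : ℝ))).sub (hasDerivAt_exp_smul_const (A + B) (0 : ℝ))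
    refine h.congr_deriv ?_
    simp
  have hu : Tendsto (fun n : ℕ => (n : ℝ)⁻¹) atTop (𝓝[≠] 0) := by
    refine tendsto_nhdsWithin_iff.2 ⟨tendsto_inv_atTop_nhds_zero_nat, ?_⟩
    filter_upwards [eventually_gt_atTop 0] with n hn
    simp [hn.ne']
  have hq : Tendsto (fun n : ℕ => (n : ℝ) * ‖exp ((n : ℝ)⁻¹ • A) * exp ((n : ℝ)⁻¹ • B)
      - exp ((n : ℝ)⁻¹ • (A + B))‖) atTop (𝓝 0) := by
    have h := (hasDerivAt_iff_tendsto_slope_zero.1 hd).comp hu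
    have h' := h.norm
    rw [norm_zero] at h'
    refine h'.congr fun n => ?_
    simp [norm_smul]
  set c := ‖A‖ + ‖B‖
  have key : ∀ᶠ n : ℕ in atTop, ‖(exp ((n : ℝ)⁻¹ • A) * exp ((n : ℝ)⁻¹ • B)) ^ n - exp (A + B)‖
      ≤ Real.exp c * ((n : ℝ) * ‖exp ((n : ℝ)⁻¹ • A) * exp ((n : ℝ)⁻¹ • B)
      - exp ((n : ℝ)⁻¹ • (A + B))‖) := by
    filter_upwards [eventually_gt_atTop 0] with n hn
    have hn0 : (n : ℝ) ≠ 0 := by exact_mod_cast hn.ne'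
    have hi : ∀ Z : R, ‖exp ((n : ℝ)⁻¹ • Z)‖ ≤ Real.exp ((n : ℝ)⁻¹ * ‖Z‖) := by
      intro Z
      refine (norm_exp_le_exp_norm h1 _).trans (le_of_eq ?_)
      rw [norm_smul, Real.norm_of_nonneg (by positivity)]
    have hX : ‖exp ((n : ℝ)⁻¹ • A) * exp ((n : ℝ)⁻¹ • B)‖ ≤ Real.exp ((n : ℝ)⁻¹ * c) := by
      rw [mul_add, Real.exp_add]
      exact (norm_mul_le _ _).trans
        (mul_le_mul (hi A) (hi B) (norm_nonneg _) (Real.exp_pos _).le)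
    have hY : ‖exp ((n : ℝ)⁻¹ • (A + B))‖ ≤ Real.exp ((n : ℝ)⁻¹ * c) :=
      (hi _).trans (Real.exp_le_exp.2 (by gcongr; exact norm_add_le A B))
    have hC : 1 ≤ Real.exp ((n : ℝ)⁻¹ * c) := Real.one_le_exp (by positivity)
    have h := norm_pow_sub_pow_le_of_norm_le hC h1 hX hY n
    have e1 : exp ((n : ℝ)⁻¹ • (A + B)) ^ n = exp (A + B) := by
      rw [← exp_nsmul, ← Nat.cast_smul_eq_nsmul ℝ, smul_smul, mul_inv_cancel₀ hn0, one_smul]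
    have e2 : Real.exp ((n : ℝ)⁻¹ * c) ^ n = Real.exp c := by
      rw [← Real.exp_nat_mul, ← mul_assoc, mul_inv_cancel₀ hn0, one_mul]
    rw [e1, e2] at h
    linarith
  rw [tendsto_iff_norm_sub_tendsto_zero]
  refine squeeze_zero' (.of_forall fun n => norm_nonneg _) key ?_
  simpa using hq.const_mul (Real.exp c)

end LieTrotter

/-! ### The Golden-Thompson inequality -/

section GoldenThompson

open Filter Topology NormedSpace

variable {E : Type*} [NormedAddCommGroup E] [InnerProductSpace ℝ E] [FiniteDimensional ℝ E]

/-- The Golden-Thompson inequality. -/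
theorem opTrace_exp_add_le {A B : E →L[ℝ] E} (hA : IsSelfAdjoint A) (hB : IsSelfAdjoint B) :
    opTrace (exp (A + B)) ≤ opTrace (exp A * exp B) := by
  let _ : NormedAlgebra ℚ (E →L[ℝ] E) := NormedAlgebra.restrictScalars ℚ ℝ _
  -- The limit is taken along n = 2^j, the exponents for which the trace inequality is available.
  have h := (tendsto_exp_mul_exp_pow (R := E →L[ℝ] E) ContinuousLinearMap.norm_id_le A B).comp
    (tendsto_pow_atTop_atTop_of_one_lt (one_lt_two (α := ℕ)))
  refine le_of_tendsto (continuous_opTrace.continuousAt.tendsto.comp h) (.of_forall fun j => ?_)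
  have hs : ∀ {Z : E →L[ℝ] E}, IsSelfAdjoint Z →
      IsSelfAdjoint (exp (((2 ^ j : ℕ) : ℝ)⁻¹ • Z)) := fun hZ =>
    IsSelfAdjoint.exp ((IsSelfAdjoint.all _).smul hZ)
  have hp : ∀ Z : E →L[ℝ] E, exp (((2 ^ j : ℕ) : ℝ)⁻¹ • Z) ^ 2 ^ j = exp Z := by
    intro Z
    rw [← exp_nsmul, ← Nat.cast_smul_eq_nsmul ℝ, smul_smul, mul_inv_cancel₀ (by positivity),
      one_smul]
  have := (opTrace_pow_pow_two_le j).2 _ _ (hs hA) (hs hB)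
  rwa [hp, hp] at this

end GoldenThompson

/-! ### Quadratic forms and traces of operator exponentials -/

section ExpQuadraticForm

open NormedSpace

variable {E : Type*} [NormedAddCommGroup E] [InnerProductSpace ℝ E]

theorem norm_pow_apply_le (A : E →L[ℝ] E) {L : ℝ} (hL : ‖A‖ ≤ L) (n : ℕ) (v : E) :
    ‖(A ^ n) v‖ ≤ L ^ n * ‖v‖ := by
  induction n with
  | zero => simp
  | succ n ih =>
    rw [pow_succ', pow_succ', mul_apply_eq_comp]
    have hL0 : 0 ≤ L := (norm_nonneg _).trans hL
    calc ‖A ((A ^ n) v)‖ ≤ L * (L ^ n * ‖v‖) :=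
          (A.le_opNorm _).trans (mul_le_mul hL ih (norm_nonneg _) hL0)
      _ = _ := by ring

/-- By Parseval, an operator diagonal in an orthonormal basis has norm at most the largest |c i|.
Positivity of t excludes the empty basis. -/
theorem exists_le_abs_eigenvalue {ι : Type*} [Fintype ι] (b : OrthonormalBasis ι ℝ E)
    {A : E →L[ℝ] E} {c : ι → ℝ} (h : ∀ i, A (b i) = c i • b i) {t : ℝ} (ht : 0 < t)
    (hA : t ≤ ‖A‖) : ∃ i, t ≤ |c i| := by
  by_contra! hc
  obtain ⟨C, hC0, hCt, hC⟩ : ∃ C, 0 ≤ C ∧ C < t ∧ ∀ i, |c i| ≤ C := by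
    cases isEmpty_or_nonempty ι
    · exact ⟨0, le_rfl, ht, fun i => isEmptyElim i⟩
    · obtain ⟨i, hi⟩ := Finite.exists_max fun i => |c i|
      exact ⟨|c i|, abs_nonneg _, hc i, hi⟩
  refine absurd (A.opNorm_le_bound hC0 fun v => ?_) (not_le.2 (hCt.trans_le hA))
  have e : A v = ∑ i, (c i * b.repr v i) • b i := by
    conv_lhs => rw [← b.sum_repr v]
    rw [map_sum]
    exact Finset.sum_congr rfl fun i _ => by rw [map_smul, h, smul_smul, mul_comm]
  refine le_of_sq_le_sq ?_ (by positivity)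
  rw [mul_pow, ← b.sum_sq_norm_inner_right (A v), ← b.sum_sq_norm_inner_right v, Finset.mul_sum]
  refine Finset.sum_le_sum fun i _ => ?_
  have e2 : inner ℝ (b i) (A v) = c i * inner ℝ (b i) v := by
    rw [e, b.orthonormal.inner_right_fintype, b.repr_apply_apply]
  rw [e2, norm_mul, mul_pow, Real.norm_eq_abs (c i)]
  gcongr
  exact hC i

variable [FiniteDimensional ℝ E]

theorem IsSelfAdjoint.inner_apply_left {A : E →L[ℝ] E} (hA : IsSelfAdjoint A) (x y : E) :
    inner ℝ (A x) y = inner ℝ x (A y) := by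
  have h := ContinuousLinearMap.adjoint_inner_left A y x
  rwa [← ContinuousLinearMap.star_eq_adjoint, hA.star_eq] at h

theorem hasSum_inner_exp_apply (A : E →L[ℝ] E) (v w : E) :
    HasSum (fun n : ℕ => (n.factorial⁻¹ : ℝ) * inner ℝ w ((A ^ n) v)) (inner ℝ w (exp A v)) := by
  have h := exp_series_hasSum_exp' (𝕂 := ℝ) A
  have h1 := h.mapL (ContinuousLinearMap.apply ℝ E v)
  have h2 := h1.mapL (innerSL ℝ w)
  simpa [inner_smul_right] using h2

/-- Bernstein's bound on the exponential of a bounded self-adjoint operator, as an inequality of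
quadratic forms. -/
theorem inner_exp_smul_apply_le {Z : E →L[ℝ] E} (hZ : IsSelfAdjoint Z) {L θ : ℝ} (hL : ‖Z‖ ≤ L)
    (hθ : 0 ≤ θ) (hθL : θ * L / 3 < 1) (v : E) :
    inner ℝ v (exp (θ • Z) v) ≤ ‖v‖ ^ 2 + θ * inner ℝ v (Z v)
      + (θ ^ 2 / 2) / (1 - θ * L / 3) * ‖Z v‖ ^ 2 := by
  have hL0 : 0 ≤ L := (norm_nonneg _).trans hL
  -- Split off the terms of order 0 and 1. Since (n+2)! ≥ 2·3ⁿ, the rest is dominated by a geometric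
  -- series of ratio θL/3.
  have hs := (hasSum_nat_add_iff' 2).2 (hasSum_inner_exp_apply (θ • Z) v v)
  have hg := ((hasSum_geometric_of_lt_one (r := θ * L / 3) (by positivity) hθL).mul_left
    (θ ^ 2 / 2 * ‖Z v‖ ^ 2))
  have hle := hasSum_le (fun n => ?_) hs hg
  · simp only [Finset.sum_range_succ, Finset.sum_range_zero, Nat.factorial, pow_zero, pow_one,
      one_apply_eq_self, real_inner_self_eq_norm_sq, smul_apply,
      inner_smul_right] at hle
    norm_num at hle
    rw [div_eq_mul_inv (θ ^ 2 / 2)]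
    linarith
  · have h1 : inner ℝ v (((θ • Z) ^ (n + 2)) v) = θ ^ (n + 2) * inner ℝ (Z v) ((Z ^ n) (Z v)) := by
      rw [smul_pow, smul_apply, inner_smul_right, pow_succ' Z, pow_succ Z,
        mul_apply_eq_comp, mul_apply_eq_comp, hZ.inner_apply_left]
    have h2 : inner ℝ (Z v) ((Z ^ n) (Z v)) ≤ L ^ n * ‖Z v‖ ^ 2 := by
      refine (real_inner_le_norm _ _).trans ?_
      have := mul_le_mul_of_nonneg_left (norm_pow_apply_le Z hL n (Z v)) (norm_nonneg (Z v))
      linarith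
    have h3 : (2 : ℝ) * 3 ^ n ≤ ((n + 2).factorial : ℝ) := by
      have := Nat.factorial_mul_pow_le_factorial (m := 2) (n := n)
      rw [add_comm 2 n] at this
      exact_mod_cast this
    rw [h1]
    calc ((n + 2).factorial⁻¹ : ℝ) * (θ ^ (n + 2) * inner ℝ (Z v) ((Z ^ n) (Z v)))
        ≤ ((n + 2).factorial⁻¹ : ℝ) * (θ ^ (n + 2) * (L ^ n * ‖Z v‖ ^ 2)) := by gcongr
      _ ≤ (2 * 3 ^ n : ℝ)⁻¹ * (θ ^ (n + 2) * (L ^ n * ‖Z v‖ ^ 2)) := by gcongr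
      _ = _ := by
        rw [div_pow, mul_pow]
        field_simp
        ring

/-- Averaging `inner_exp_smul_apply_le` over a centred family of operators. -/
theorem sum_inner_exp_smul_apply_le {W : Type*} [Fintype W] {p : W → ℝ} (hp : ∀ w, 0 ≤ p w)
    (hp1 : ∑ w, p w = 1) {Z : W → E →L[ℝ] E} (hZ : ∀ w, IsSelfAdjoint (Z w)) {L θ σ : ℝ}
    (hL : ∀ w, ‖Z w‖ ≤ L) (hθ : 0 ≤ θ) (hθL : θ * L / 3 < 1) (hmean : ∑ w, p w • Z w = 0)
    (hvar : ∀ v, ∑ w, p w * ‖Z w v‖ ^ 2 ≤ σ * ‖v‖ ^ 2) (v : E) :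
    ∑ w, p w * inner ℝ v (exp (θ • Z w) v)
      ≤ Real.exp ((θ ^ 2 / 2) / (1 - θ * L / 3) * σ) * ‖v‖ ^ 2 := by
  set g := (θ ^ 2 / 2) / (1 - θ * L / 3)
  have hg : 0 ≤ g := div_nonneg (by positivity) (by linarith)
  have hm : ∑ w, p w * inner ℝ v (Z w v) = 0 := by
    have h := congrArg (fun A : E →L[ℝ] E => inner ℝ v (A v)) hmean
    simpa [sum_apply, inner_sum, inner_smul_right] using h
  calc ∑ w, p w * inner ℝ v (exp (θ • Z w) v)
      ≤ ∑ w, p w * (‖v‖ ^ 2 + θ * inner ℝ v (Z w v) + g * ‖Z w v‖ ^ 2) :=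
        Finset.sum_le_sum fun w _ => mul_le_mul_of_nonneg_left
          (inner_exp_smul_apply_le (hZ w) (hL w) hθ hθL v) (hp w)
    _ = (∑ w, p w) * ‖v‖ ^ 2 + θ * (∑ w, p w * inner ℝ v (Z w v))
        + g * ∑ w, p w * ‖Z w v‖ ^ 2 := by
        simp only [Finset.mul_sum, Finset.sum_mul, ← Finset.sum_add_distrib]
        exact Finset.sum_congr rfl fun w _ => by ring
    _ ≤ (1 + g * σ) * ‖v‖ ^ 2 := by
        rw [hp1, hm]
        have := mul_le_mul_of_nonneg_left (hvar v) hg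
        linarith
    _ ≤ _ := by
        gcongr
        rw [add_comm]
        exact Real.add_one_le_exp _

/-- With C = exp(H/2), cyclicity gives tr(exp(H) B) = tr(CBC), a sum of values of the quadratic form
of B at the vectors C b_i. So B itself need not be self-adjoint. -/
theorem opTrace_exp_mul_le {H B : E →L[ℝ] E} (hH : IsSelfAdjoint H) {c : ℝ}
    (hB : ∀ v, inner ℝ v (B v) ≤ c * ‖v‖ ^ 2) :
    opTrace (exp H * B) ≤ c * opTrace (exp H) := by
  let _ : NormedAlgebra ℚ (E →L[ℝ] E) := NormedAlgebra.restrictScalars ℚ ℝ _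
  obtain ⟨C, hC, e⟩ : ∃ C : E →L[ℝ] E, IsSelfAdjoint C ∧ exp H = star C * C := by
    have hC : IsSelfAdjoint (exp ((2 : ℝ)⁻¹ • H)) :=
      IsSelfAdjoint.exp ((IsSelfAdjoint.all _).smul hH)
    refine ⟨_, hC, ?_⟩
    rw [hC.star_eq, ← exp_add_of_commute (Commute.refl _), ← add_smul]
    norm_num
  rw [e, mul_assoc, opTrace_mul_comm, hC.star_eq, mul_assoc]
  nth_rw 1 [← hC.star_eq]
  nth_rw 3 [← hC.star_eq]
  rw [opTrace_star_mul (stdOrthonormalBasis ℝ E), opTrace_star_mul (stdOrthonormalBasis ℝ E),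
    Finset.mul_sum]
  refine Finset.sum_le_sum fun i _ => ?_
  rw [real_inner_self_eq_norm_sq]
  exact hB _

theorem exp_apply_of_apply_eq_smul {A : E →L[ℝ] E} {v : E} {c : ℝ} (h : A v = c • v) :
    exp A v = Real.exp c • v := by
  have hp : ∀ n : ℕ, (A ^ n) v = c ^ n • v := by
    intro n
    induction n with
    | zero => simp
    | succ n ih => rw [pow_succ', mul_apply_eq_comp, ih, map_smul, h, smul_smul, pow_succ]
  have h1 := (exp_series_hasSum_exp' (𝕂 := ℝ) A).mapL (ContinuousLinearMap.apply ℝ E v)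
  have h2 := (exp_series_hasSum_exp' (𝕂 := ℝ) c).smul_const v
  rw [← Real.exp_eq_exp_ℝ] at h2
  refine HasSum.unique (f := fun n : ℕ => ((n.factorial : ℝ)⁻¹ * c ^ n) • v) ?_ h2
  simpa [hp, smul_smul] using h1

theorem opTrace_exp_eq_sum {ι : Type*} [Fintype ι] (b : OrthonormalBasis ι ℝ E) {A : E →L[ℝ] E}
    {c : ι → ℝ} (h : ∀ i, A (b i) = c i • b i) : opTrace (exp A) = ∑ i, Real.exp (c i) := by
  rw [opTrace_eq_sum_inner b]
  refine Finset.sum_congr rfl fun i _ => ?_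
  rw [exp_apply_of_apply_eq_smul (h i), inner_smul_right, real_inner_self_eq_norm_sq]
  simp

/-- If the norm of a self-adjoint operator is large, so is the trace of the exponential of
the operator or of its negative. -/
theorem exp_le_opTrace_exp {S : E →L[ℝ] E} (hS : IsSelfAdjoint S) {t θ : ℝ} (ht : 0 < t)
    (hθ : 0 ≤ θ) (hSt : t ≤ ‖S‖) :
    Real.exp (θ * t) ≤ opTrace (exp (θ • S)) ∨ Real.exp (θ * t) ≤ opTrace (exp (θ • -S)) := by
  have hsym : (S : E →ₗ[ℝ] E).IsSymmetric := fun x y => hS.inner_apply_left x y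
  set b := hsym.eigenvectorBasis rfl
  set c := hsym.eigenvalues rfl
  have hb : ∀ i, S (b i) = c i • b i := fun i => hsym.apply_eigenvectorBasis rfl i
  obtain ⟨i, hi⟩ := exists_le_abs_eigenvalue b hb ht hSt
  -- The sign of the large eigenvalue decides between S and -S; the other eigenvalues only add
  -- positive terms to the trace.
  rcases le_abs'.1 hi with h | h
  · right
    rw [opTrace_exp_eq_sum b (c := fun i => θ * -c i) fun i => by simp [hb, smul_smul]]
    refine le_trans ?_ (Finset.single_le_sum (f := fun i => Real.exp (θ * -c i))
      (fun i _ => (Real.exp_pos _).le) (Finset.mem_univ i))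
    exact Real.exp_le_exp.2 (mul_le_mul_of_nonneg_left (by linarith) hθ)
  · left
    rw [opTrace_exp_eq_sum b (c := fun i => θ * c i) fun i => by simp [hb, smul_smul]]
    refine le_trans ?_ (Finset.single_le_sum (f := fun i => Real.exp (θ * c i))
      (fun i _ => (Real.exp_pos _).le) (Finset.mem_univ i))
    exact Real.exp_le_exp.2 (mul_le_mul_of_nonneg_left h hθ)

theorem opTrace_exp_nonneg {S : E →L[ℝ] E} (hS : IsSelfAdjoint S) : 0 ≤ opTrace (exp S) := by
  have hsym : (S : E →ₗ[ℝ] E).IsSymmetric := fun x y => hS.inner_apply_left x y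
  rw [opTrace_exp_eq_sum (hsym.eigenvectorBasis rfl) fun i => hsym.apply_eigenvectorBasis rfl i]
  positivity

end ExpQuadraticForm

/-! ### The operator Bernstein inequality -/

section OperatorBernstein

open NormedSpace

variable {E : Type*} [NormedAddCommGroup E] [InnerProductSpace ℝ E] [FiniteDimensional ℝ E]
  {Ω : Type*} [MeasurableSpace Ω] {P : Measure Ω} [IsProbabilityMeasure P]
  {W : Type*} [Fintype W] [MeasurableSpace W] [MeasurableSingletonClass W]

theorem integrable_comp_of_finite {V : Type*} [Finite V] [MeasurableSpace V]
    [MeasurableSingletonClass V] {X : Ω → V} (hX : Measurable X) (g : V → ℝ) :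
    Integrable (fun ω => g (X ω)) P :=
  (Integrable.of_finite (μ := P.map X) (f := g)).comp_measurable hX

/-- Conditioning on the value of Y. Finiteness of both ranges makes every function measurable and
integrable. -/
theorem integral_comp_prod_of_indepFun {V : Type*} [Finite V] [MeasurableSpace V]
    [MeasurableSingletonClass V] {X : Ω → V} {Y : Ω → W} (hX : Measurable X) (hY : Measurable Y)
    (h : IndepFun X Y P) (f : V → W → ℝ) :
    ∫ ω, f (X ω) (Y ω) ∂P = ∑ w, P.real (Y ⁻¹' {w}) * ∫ ω, f (X ω) w ∂P := by
  classical
  have e : ∀ ω, f (X ω) (Y ω) = ∑ w, f (X ω) w * (if Y ω = w then 1 else 0) := by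
    intro ω; simp
  have hm : ∀ g : V → ℝ, Measurable g := fun g => .of_discrete
  have hm' : ∀ g : W → ℝ, Measurable g := fun g => .of_discrete
  simp_rw [e]
  rw [integral_finsetSum _ fun w _ =>
    integrable_comp_of_finite (hX.prodMk hY) fun q : V × W => f q.1 w * if q.2 = w then 1 else 0]
  refine Finset.sum_congr rfl fun w _ => ?_
  have hi := h.comp (hm fun x => f x w) (hm' fun y => if y = w then 1 else 0)
  have h2 := hi.integral_fun_mul_eq_mul_integral
    ((hm _).comp hX).aestronglyMeasurable ((hm' _).comp hY).aestronglyMeasurable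
  simp only [Function.comp_apply] at h2
  rw [h2, mul_comm]
  congr 1
  have e3 : (fun ω => if Y ω = w then (1 : ℝ) else 0) = (Y ⁻¹' {w}).indicator 1 := by
    ext ω; simp [Set.indicator_apply]
  rw [e3, integral_indicator_one (hY (measurableSet_singleton w))]

/-- The Ahlswede-Winter bound on the trace of the moment generating function of a sum of
independent self-adjoint operators. -/
theorem integral_opTrace_exp_sum_le {ι : Type*} {s : ι → Ω → W} (hs : ∀ i, Measurable (s i))
    (hind : iIndepFun s P) {p : W → ℝ} (hp : ∀ i w, P.real (s i ⁻¹' {w}) = p w)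
    {Y : W → E →L[ℝ] E} (hY : ∀ w, IsSelfAdjoint (Y w)) {c : ℝ} (hc0 : 0 ≤ c)
    (hc : ∀ v, ∑ w, p w * inner ℝ v (exp (Y w) v) ≤ c * ‖v‖ ^ 2) (t : Finset ι) :
    ∫ ω, opTrace (exp (∑ i ∈ t, Y (s i ω))) ∂P ≤ Module.finrank ℝ E * c ^ t.card := by
  classical
  induction t using Finset.induction_on with
  | empty => simp [opTrace_one]
  | insert j t hj ih =>
    have hsa : ∀ x : ι → W, IsSelfAdjoint (∑ i ∈ t, Y (x i)) := fun x =>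
      isSelfAdjoint_sum _ fun i _ => hY _
    -- The earlier samples are bundled into one variable with finitely many values, independent of
    -- the new sample.
    set X : Ω → t → W := fun ω i => s i ω
    have hX : Measurable X := measurable_pi_lambda _ fun i => hs i
    have hsum : ∀ ω, ∑ i ∈ t, Y (s i ω) = ∑ i : t, Y (X ω i) := fun ω =>
      (Finset.sum_coe_sort t fun i => Y (s i ω)).symm
    have hXj : IndepFun X (s j) P := by
      have h := hind.indepFun_finset t {j} (Finset.disjoint_singleton_right.2 hj) hs
      exact h.comp measurable_id
        (measurable_pi_apply (⟨j, Finset.mem_singleton_self j⟩ : ({j} : Finset ι)))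
    have hint : ∀ B : E →L[ℝ] E,
        Integrable (fun ω => opTrace (exp (∑ i ∈ t, Y (s i ω)) * B)) P := fun B => by
      simp_rw [hsum]
      exact integrable_comp_of_finite hX fun x => opTrace (exp (∑ i : t, Y (x i)) * B)
    have hB : ∀ v, inner ℝ v ((∑ w, p w • exp (Y w)) v) ≤ c * ‖v‖ ^ 2 := by
      intro v
      simpa [sum_apply, inner_sum, inner_smul_right] using hc v
    -- In order: Golden-Thompson, conditioning on the new sample, linearity, the quadratic form
    -- bound on the mean exponential, and induction.
    calc ∫ ω, opTrace (exp (∑ i ∈ insert j t, Y (s i ω))) ∂P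
        ≤ ∫ ω, opTrace (exp (∑ i ∈ t, Y (s i ω)) * exp (Y (s j ω))) ∂P := by
          refine integral_mono ?_ ?_ fun ω => ?_
          · simp_rw [Finset.sum_insert hj, hsum]
            exact integrable_comp_of_finite (hX.prodMk (hs j)) fun q : (t → W) × W =>
              opTrace (exp (Y q.2 + ∑ i : t, Y (q.1 i)))
          · simp_rw [hsum]
            exact integrable_comp_of_finite (hX.prodMk (hs j)) fun q : (t → W) × W =>
              opTrace (exp (∑ i : t, Y (q.1 i)) * exp (Y q.2))
          · simp only
            rw [Finset.sum_insert hj, add_comm]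
            exact opTrace_exp_add_le (hsa fun i => s i ω) (hY _)
      _ = ∑ w, p w * ∫ ω, opTrace (exp (∑ i ∈ t, Y (s i ω)) * exp (Y w)) ∂P := by
          simp_rw [hsum]
          rw [integral_comp_prod_of_indepFun hX (hs j) hXj fun x w =>
            opTrace (exp (∑ i : t, Y (x i)) * exp (Y w))]
          simp_rw [hp]
      _ = ∫ ω, opTrace (exp (∑ i ∈ t, Y (s i ω)) * ∑ w, p w • exp (Y w)) ∂P := by
          simp_rw [Finset.mul_sum, map_sum, mul_smul_comm, map_smul, smul_eq_mul]
          rw [integral_finsetSum _ fun w _ => (hint _).const_mul _]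
          simp_rw [integral_const_mul]
      _ ≤ ∫ ω, c * opTrace (exp (∑ i ∈ t, Y (s i ω))) ∂P := by
          refine integral_mono (hint _) ?_ fun ω => opTrace_exp_mul_le (hsa fun i => s i ω) hB
          simpa using (hint 1).const_mul c
      _ ≤ c * (Module.finrank ℝ E * c ^ t.card) := by
          rw [integral_const_mul]
          gcongr
      _ = _ := by rw [Finset.card_insert_of_notMem hj, pow_succ]; ring

/-- One tail of the operator Bernstein inequality. -/
theorem measureReal_exp_le_opTrace_exp_le {ι : Type*} {s : ι → Ω → W}
    (hs : ∀ i, Measurable (s i)) (hind : iIndepFun s P) {p : W → ℝ}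
    (hp : ∀ i w, P.real (s i ⁻¹' {w}) = p w) (hp1 : ∑ w, p w = 1) (hp0 : ∀ w, 0 ≤ p w)
    {Z : W → E →L[ℝ] E} (hZ : ∀ w, IsSelfAdjoint (Z w)) {L σ t : ℝ} (hL : ∀ w, ‖Z w‖ ≤ L)
    (hmean : ∑ w, p w • Z w = 0) (hvar : ∀ v, ∑ w, p w * ‖Z w v‖ ^ 2 ≤ σ * ‖v‖ ^ 2)
    (hL0 : 0 ≤ L) (hσ : 0 < σ) (ht : 0 < t) {B : Finset ι} (hB : 0 < B.card) {θ : ℝ}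
    (hθ : θ = t / (B.card * σ + L * t / 3)) :
    P.real {ω | Real.exp (θ * t) ≤ opTrace (exp (θ • ∑ i ∈ B, Z (s i ω)))}
      ≤ Module.finrank ℝ E * Real.exp (-((t ^ 2 / 2) / (B.card * σ + L * t / 3))) := by
  have hm : (0 : ℝ) < B.card := by exact_mod_cast hB
  have hD : 0 < B.card * σ + L * t / 3 := by positivity
  have hθ0 : 0 ≤ θ := by rw [hθ]; positivity
  -- With D = mσ + Lt/3, where m is the number of summands, the choice θ = t/D makes this factor
  -- mσ/D. The exponent becomes θ²D/2 - θt = -t²/(2D).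
  have e1 : 1 - θ * L / 3 = B.card * σ / (B.card * σ + L * t / 3) := by
    rw [hθ]; field_simp; ring
  have hθL : θ * L / 3 < 1 := by
    have : 0 < 1 - θ * L / 3 := by rw [e1]; positivity
    linarith
  have hsa : ∀ w, IsSelfAdjoint (θ • Z w) := fun w => (IsSelfAdjoint.all θ).smul (hZ w)
  have hI := integral_opTrace_exp_sum_le hs hind hp hsa (Real.exp_pos _).le
    (sum_inner_exp_smul_apply_le hp0 hp1 hZ hL hθ0 hθL hmean hvar) B
  simp_rw [← Finset.smul_sum] at hI
  have hint : Integrable (fun ω => opTrace (exp (θ • ∑ i ∈ B, Z (s i ω)))) P := by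
    have hX : Measurable fun ω (i : B) => s i ω := measurable_pi_lambda _ fun i => hs i
    have := integrable_comp_of_finite (P := P) hX fun x => opTrace (exp (θ • ∑ i : B, Z (x i)))
    refine this.congr (.of_forall fun ω => ?_)
    simp only
    rw [Finset.sum_coe_sort B fun i => Z (s i ω)]
  -- Markov's inequality for the trace of the exponential.
  have hM := mul_meas_ge_le_integral_of_nonneg (μ := P) (.of_forall fun ω => opTrace_exp_nonneg
    ((IsSelfAdjoint.all θ).smul (isSelfAdjoint_sum B fun i _ => hZ (s i ω)))) hint
    (Real.exp (θ * t))
  have h := hM.trans hI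
  rw [← Real.exp_nat_mul] at h
  have e2 : B.card * (θ ^ 2 / 2 / (1 - θ * L / 3) * σ) - θ * t
      = -((t ^ 2 / 2) / (B.card * σ + L * t / 3)) := by
    rw [e1, hθ]; field_simp; ring
  rw [← e2, Real.exp_sub, mul_div_assoc', le_div_iff₀ (Real.exp_pos _), mul_comm]
  exact h

/-- The operator Bernstein inequality for sums of identically distributed random self-adjoint
operators that take finitely many values. -/
theorem measureReal_le_norm_sum_le {ι : Type*} {s : ι → Ω → W}
    (hs : ∀ i, Measurable (s i)) (hind : iIndepFun s P) {p : W → ℝ}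
    (hp : ∀ i w, P.real (s i ⁻¹' {w}) = p w) (hp1 : ∑ w, p w = 1) (hp0 : ∀ w, 0 ≤ p w)
    {Z : W → E →L[ℝ] E} (hZ : ∀ w, IsSelfAdjoint (Z w)) {L σ t : ℝ} (hL : ∀ w, ‖Z w‖ ≤ L)
    (hmean : ∑ w, p w • Z w = 0) (hvar : ∀ v, ∑ w, p w * ‖Z w v‖ ^ 2 ≤ σ * ‖v‖ ^ 2)
    (hL0 : 0 ≤ L) (hσ : 0 < σ) (ht : 0 < t) {B : Finset ι} (hB : 0 < B.card) :
    P.real {ω | t ≤ ‖∑ i ∈ B, Z (s i ω)‖}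
      ≤ 2 * Module.finrank ℝ E * Real.exp (-((t ^ 2 / 2) / (B.card * σ + L * t / 3))) := by
  set θ := t / (B.card * σ + L * t / 3) with hθ
  have h1 := measureReal_exp_le_opTrace_exp_le hs hind hp hp1 hp0 hZ hL hmean hvar hL0 hσ ht hB hθ
  -- The lower tail is the upper tail of -Z, whence the factor 2.
  have h2 := measureReal_exp_le_opTrace_exp_le hs hind hp hp1 hp0 (Z := fun w => -Z w)
    (fun w => (hZ w).neg) (by simpa using hL) (by simpa using hmean) (by simpa using hvar)
    hL0 hσ ht hB hθ
  have hsub : {ω | t ≤ ‖∑ i ∈ B, Z (s i ω)‖} ⊆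
      {ω | Real.exp (θ * t) ≤ opTrace (exp (θ • ∑ i ∈ B, Z (s i ω)))} ∪
      {ω | Real.exp (θ * t) ≤ opTrace (exp (θ • ∑ i ∈ B, -Z (s i ω)))} := by
    intro ω hω
    simp only [Set.mem_union, Set.mem_ofPred_eq, Finset.sum_neg_distrib]
    exact exp_le_opTrace_exp (isSelfAdjoint_sum B fun i _ => hZ (s i ω)) ht
      (by positivity) hω
  have := (measureReal_mono (μ := P) hsub).trans (measureReal_union_le _ _)
  linarith

end OperatorBernstein

/-! ### Tensor products of operators on unit tensors -/

section Tensors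

variable {d₁ d₂ d₃ : ℕ}

theorem euclideanSpace_clm_ext {ι F : Type*} [Fintype ι] [DecidableEq ι] [AddCommGroup F]
    [Module ℝ F] [TopologicalSpace F] {A B : EuclideanSpace ℝ ι →L[ℝ] F}
    (h : ∀ i, A (EuclideanSpace.single i 1) = B (EuclideanSpace.single i 1)) : A = B := by
  refine ContinuousLinearMap.coe_injective
    ((EuclideanSpace.basisFun ι ℝ).toBasis.ext fun i => ?_)
  simpa using h i

theorem single_eq_outer (w : Idx d₁ d₂ d₃) :
    (EuclideanSpace.single w 1 : Tensor d₁ d₂ d₃) = outer (EuclideanSpace.single w.1 1)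
      (EuclideanSpace.single w.2.1 1) (EuclideanSpace.single w.2.2 1) := by
  ext x
  obtain ⟨a, b, c⟩ := w
  obtain ⟨a', b', c'⟩ := x
  by_cases h1 : a' = a <;> by_cases h2 : b' = b <;> by_cases h3 : c' = c <;>
    simp [outer, h1, h2, h3]

theorem inner_outer (u u' : EuclideanSpace ℝ (Fin d₁)) (v v' : EuclideanSpace ℝ (Fin d₂))
    (w w' : EuclideanSpace ℝ (Fin d₃)) :
    inner ℝ (outer u v w) (outer u' v' w') = inner ℝ u u' * inner ℝ v v' * inner ℝ w w' := by
  have e : ∀ a b c, u' a * v' b * w' c * (u a * v b * w c)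
      = u' a * u a * (v' b * v b * (w' c * w c)) := fun a b c => by ring
  simp only [PiLp.inner_apply, RCLike.inner_apply, conj_trivial, outer, Fintype.sum_prod_type, e,
    ← Finset.mul_sum, ← Finset.sum_mul]
  ring

theorem tensorMap_mul (A A' : EuclideanSpace ℝ (Fin d₁) →L[ℝ] EuclideanSpace ℝ (Fin d₁))
    (B B' : EuclideanSpace ℝ (Fin d₂) →L[ℝ] EuclideanSpace ℝ (Fin d₂))
    (C C' : EuclideanSpace ℝ (Fin d₃) →L[ℝ] EuclideanSpace ℝ (Fin d₃)) :
    tensorMap A B C * tensorMap A' B' C' = tensorMap (A * A') (B * B') (C * C') := by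
  refine euclideanSpace_clm_ext fun w => ?_
  rw [single_eq_outer, mul_apply_eq_comp, tensorMap_outer, tensorMap_outer, tensorMap_outer]
  simp only [mul_apply_eq_comp]

theorem inner_single_tensorMap_single
    (A : EuclideanSpace ℝ (Fin d₁) →L[ℝ] EuclideanSpace ℝ (Fin d₁))
    (B : EuclideanSpace ℝ (Fin d₂) →L[ℝ] EuclideanSpace ℝ (Fin d₂))
    (C : EuclideanSpace ℝ (Fin d₃) →L[ℝ] EuclideanSpace ℝ (Fin d₃)) (x y : Idx d₁ d₂ d₃) :
    inner ℝ (EuclideanSpace.single x 1) (tensorMap A B C (EuclideanSpace.single y 1)) =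
      inner ℝ (EuclideanSpace.single x.1 1) (A (EuclideanSpace.single y.1 1)) *
      inner ℝ (EuclideanSpace.single x.2.1 1) (B (EuclideanSpace.single y.2.1 1)) *
      inner ℝ (EuclideanSpace.single x.2.2 1) (C (EuclideanSpace.single y.2.2 1)) := by
  rw [single_eq_outer, single_eq_outer, tensorMap_outer, inner_outer]

/-- Each matrix entry is a product of entries of the three factors, so symmetry is inherited from
them. -/
theorem isSelfAdjoint_tensorMap {A : EuclideanSpace ℝ (Fin d₁) →L[ℝ] EuclideanSpace ℝ (Fin d₁)}
    {B : EuclideanSpace ℝ (Fin d₂) →L[ℝ] EuclideanSpace ℝ (Fin d₂)}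
    {C : EuclideanSpace ℝ (Fin d₃) →L[ℝ] EuclideanSpace ℝ (Fin d₃)} (hA : IsSelfAdjoint A)
    (hB : IsSelfAdjoint B) (hC : IsSelfAdjoint C) : IsSelfAdjoint (tensorMap A B C) := by
  refine euclideanSpace_clm_ext fun y => ?_
  ext x
  have key : inner ℝ (EuclideanSpace.single x (1 : ℝ))
      (star (tensorMap A B C) (EuclideanSpace.single y 1)) =
      inner ℝ (EuclideanSpace.single x (1 : ℝ)) (tensorMap A B C (EuclideanSpace.single y 1)) := by
    rw [ContinuousLinearMap.star_eq_adjoint, ContinuousLinearMap.adjoint_inner_right,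
      real_inner_comm, inner_single_tensorMap_single, inner_single_tensorMap_single,
      ← hA.inner_apply_left, ← hB.inner_apply_left, ← hC.inner_apply_left]
    simp only [real_inner_comm]
  simpa [EuclideanSpace.inner_single_left] using key

/-! ### Coherence and orthogonal projections -/

section Coherence

variable {k : ℕ} (U : Submodule ℝ (EuclideanSpace ℝ (Fin k)))

theorem inner_single_starProjection_single (i : Fin k) :
    inner ℝ (EuclideanSpace.single i 1) (U.starProjection (EuclideanSpace.single i 1))
      = ‖U.starProjection (EuclideanSpace.single i (1 : ℝ))‖ ^ 2 := by
  rw [← real_inner_self_eq_norm_sq, Submodule.inner_starProjection_left_eq_right,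
    Submodule.starProjection_eq_self_iff.2 (Submodule.starProjection_apply_mem _ _)]

theorem inner_single_starProjection_orthogonal_single (i : Fin k) :
    inner ℝ (EuclideanSpace.single i 1) (Uᗮ.starProjection (EuclideanSpace.single i 1))
      = 1 - ‖U.starProjection (EuclideanSpace.single i (1 : ℝ))‖ ^ 2 := by
  rw [Submodule.starProjection_orthogonal_val, inner_sub_right,
    inner_single_starProjection_single, real_inner_self_eq_norm_sq]
  simp

theorem opTrace_starProjection {E : Type*} [NormedAddCommGroup E] [InnerProductSpace ℝ E]
    [FiniteDimensional ℝ E] (K : Submodule ℝ E) :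
    opTrace K.starProjection = Module.finrank ℝ K := by
  refine LinearMap.IsProj.trace (p := K) ⟨fun x => Submodule.starProjection_apply_mem K x,
    fun x hx => Submodule.starProjection_eq_self_iff.2 hx⟩

theorem sum_sq_norm_starProjection_single :
    ∑ i : Fin k, ‖U.starProjection (EuclideanSpace.single i (1 : ℝ))‖ ^ 2
      = Module.finrank ℝ U := by
  rw [← opTrace_starProjection, opTrace_eq_sum_inner (EuclideanSpace.basisFun (Fin k) ℝ)]
  simp only [EuclideanSpace.basisFun_apply, inner_single_starProjection_single]

theorem subspaceCoherence_nonneg : 0 ≤ subspaceCoherence U :=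
  mul_nonneg (by positivity) (Real.iSup_nonneg fun i => by positivity)

theorem sq_norm_starProjection_single_le {μ₀ : ℝ} (h : subspaceCoherence U ≤ μ₀) (i : Fin k) :
    ‖U.starProjection (EuclideanSpace.single i (1 : ℝ))‖ ^ 2 ≤ μ₀ * Module.finrank ℝ U / k := by
  have hk : (0 : ℝ) < k := by exact_mod_cast i.pos
  rcases (Module.finrank ℝ U).eq_zero_or_pos with h0 | h0
  -- For U = 0 the division by zero makes the coherence 0, so the hypothesis carries no information.
  -- The squared norms sum to dim U = 0, hence vanish.
  · have hs := sum_sq_norm_starProjection_single U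
    rw [h0, Nat.cast_zero] at hs
    rw [(Finset.sum_eq_zero_iff_of_nonneg fun i _ => by positivity).1 hs i (Finset.mem_univ i), h0]
    simp
  · have hr : (0 : ℝ) < Module.finrank ℝ U := by exact_mod_cast h0
    have hle : ‖U.starProjection (EuclideanSpace.single i (1 : ℝ))‖ ^ 2 ≤
        ⨆ i : Fin k, ‖U.starProjection (EuclideanSpace.single i (1 : ℝ))‖ ^ 2 :=
      le_ciSup (f := fun i : Fin k => ‖U.starProjection (EuclideanSpace.single i (1 : ℝ))‖ ^ 2)
        (Set.finite_range _).bddAbove i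
    have h2 : (k : ℝ) / Module.finrank ℝ U *
        ‖U.starProjection (EuclideanSpace.single i (1 : ℝ))‖ ^ 2 ≤ μ₀ :=
      (mul_le_mul_of_nonneg_left hle (by positivity)).trans h
    rw [le_div_iff₀ hk]
    rw [div_mul_eq_mul_div, div_le_iff₀ hr] at h2
    linarith

theorem starProjection_mul_self {E : Type*} [NormedAddCommGroup E] [InnerProductSpace ℝ E]
    [FiniteDimensional ℝ E] (K : Submodule ℝ E) :
    K.starProjection * K.starProjection = K.starProjection :=
  K.isIdempotentElem_starProjection

theorem starProjection_mul_starProjection_orthogonal {E : Type*} [NormedAddCommGroup E]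
    [InnerProductSpace ℝ E] [FiniteDimensional ℝ E] (K : Submodule ℝ E) :
    K.starProjection * Kᗮ.starProjection = 0 := by
  ext x
  rw [mul_apply_eq_comp, Submodule.starProjection_orthogonal_val, map_sub,
    ← mul_apply_eq_comp, starProjection_mul_self, sub_self]
  rfl

theorem starProjection_orthogonal_mul_starProjection {E : Type*} [NormedAddCommGroup E]
    [InnerProductSpace ℝ E] [FiniteDimensional ℝ E] (K : Submodule ℝ E) :
    Kᗮ.starProjection * K.starProjection = 0 := by
  ext x
  rw [mul_apply_eq_comp, Submodule.starProjection_orthogonal_val,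
    ← mul_apply_eq_comp, starProjection_mul_self, sub_self]
  rfl

end Coherence

/-! ### The projection Q_T: idempotence, diagonal entries and trace -/

theorem tensorMap_zero_left (B : EuclideanSpace ℝ (Fin d₂) →L[ℝ] EuclideanSpace ℝ (Fin d₂))
    (C : EuclideanSpace ℝ (Fin d₃) →L[ℝ] EuclideanSpace ℝ (Fin d₃)) :
    tensorMap (0 : EuclideanSpace ℝ (Fin d₁) →L[ℝ] EuclideanSpace ℝ (Fin d₁)) B C = 0 := by
  refine euclideanSpace_clm_ext fun w => ?_
  rw [single_eq_outer, tensorMap_outer]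
  ext x; simp [outer]

theorem tensorMap_zero_middle (A : EuclideanSpace ℝ (Fin d₁) →L[ℝ] EuclideanSpace ℝ (Fin d₁))
    (C : EuclideanSpace ℝ (Fin d₃) →L[ℝ] EuclideanSpace ℝ (Fin d₃)) :
    tensorMap A (0 : EuclideanSpace ℝ (Fin d₂) →L[ℝ] EuclideanSpace ℝ (Fin d₂)) C = 0 := by
  refine euclideanSpace_clm_ext fun w => ?_
  rw [single_eq_outer, tensorMap_outer]
  ext x; simp [outer]

theorem tensorMap_zero_right (A : EuclideanSpace ℝ (Fin d₁) →L[ℝ] EuclideanSpace ℝ (Fin d₁))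
    (B : EuclideanSpace ℝ (Fin d₂) →L[ℝ] EuclideanSpace ℝ (Fin d₂)) :
    tensorMap A B (0 : EuclideanSpace ℝ (Fin d₃) →L[ℝ] EuclideanSpace ℝ (Fin d₃)) = 0 := by
  refine euclideanSpace_clm_ext fun w => ?_
  rw [single_eq_outer, tensorMap_outer]
  ext x; simp [outer]

variable (T : Tensor d₁ d₂ d₃)

theorem isSelfAdjoint_QProj : IsSelfAdjoint (QProj T) := by
  have h : ∀ (K₁ : Submodule ℝ (EuclideanSpace ℝ (Fin d₁)))
      (K₂ : Submodule ℝ (EuclideanSpace ℝ (Fin d₂))) (K₃ : Submodule ℝ (EuclideanSpace ℝ (Fin d₃))),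
      IsSelfAdjoint (tensorMap K₁.starProjection K₂.starProjection K₃.starProjection) :=
    fun K₁ K₂ K₃ => isSelfAdjoint_tensorMap (isSelfAdjoint_starProjection K₁)
      (isSelfAdjoint_starProjection K₂) (isSelfAdjoint_starProjection K₃)
  have hadd : ∀ A B : Tensor d₁ d₂ d₃ →L[ℝ] Tensor d₁ d₂ d₃,
      IsSelfAdjoint A → IsSelfAdjoint B → IsSelfAdjoint (A + B) := by
    intro A B hA hB
    rw [ContinuousLinearMap.isSelfAdjoint_iff'] at *
    rw [map_add, hA, hB]
  exact hadd _ _ (hadd _ _ (hadd _ _ (h _ _ _) (h _ _ _)) (h _ _ _)) (h _ _ _)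

/-- Any two distinct summands have P in one and its complement in the other in some mode, so their
product vanishes. -/
theorem QProj_mul_self : QProj T * QProj T = QProj T := by
  simp only [QProj, add_mul, mul_add, tensorMap_mul, starProjection_mul_self,
    starProjection_mul_starProjection_orthogonal, starProjection_orthogonal_mul_starProjection,
    tensorMap_zero_left, tensorMap_zero_middle, tensorMap_zero_right, add_zero, zero_add]

theorem inner_single_QProj_single (w : Idx d₁ d₂ d₃) :
    inner ℝ (EuclideanSpace.single w 1) (QProj T (EuclideanSpace.single w 1)) =
      ‖QProj T (EuclideanSpace.single w 1)‖ ^ 2 := by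
  rw [← real_inner_self_eq_norm_sq, (isSelfAdjoint_QProj T).inner_apply_left,
    ← mul_apply_eq_comp (QProj T), QProj_mul_self]

/-- The diagonal entry equals the right side minus twice the triple product, which is dropped. This
one bound yields both the pointwise and the trace estimate. -/
theorem inner_single_QProj_single_le (w : Idx d₁ d₂ d₃) :
    inner ℝ (EuclideanSpace.single w 1) (QProj T (EuclideanSpace.single w 1)) ≤
      ‖(fiberSpan₁ T).starProjection (EuclideanSpace.single w.1 1)‖ ^ 2
          * ‖(fiberSpan₂ T).starProjection (EuclideanSpace.single w.2.1 1)‖ ^ 2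
        + ‖(fiberSpan₁ T).starProjection (EuclideanSpace.single w.1 1)‖ ^ 2
          * ‖(fiberSpan₃ T).starProjection (EuclideanSpace.single w.2.2 1)‖ ^ 2
        + ‖(fiberSpan₂ T).starProjection (EuclideanSpace.single w.2.1 1)‖ ^ 2
          * ‖(fiberSpan₃ T).starProjection (EuclideanSpace.single w.2.2 1)‖ ^ 2 := by
  simp only [QProj, add_apply, inner_add_right, inner_single_tensorMap_single,
    inner_single_starProjection_orthogonal_single]
  simp only [inner_single_starProjection_single]
  have : 0 ≤ ‖(fiberSpan₁ T).starProjection (EuclideanSpace.single w.1 1)‖ ^ 2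
      * ‖(fiberSpan₂ T).starProjection (EuclideanSpace.single w.2.1 1)‖ ^ 2
      * ‖(fiberSpan₃ T).starProjection (EuclideanSpace.single w.2.2 1)‖ ^ 2 := by positivity
  linarith

theorem sq_rbar_mul : rbar T ^ 2 * ((d₁ : ℝ) + d₂ + d₃) =
    (Module.finrank ℝ (fiberSpan₁ T) : ℝ) * Module.finrank ℝ (fiberSpan₂ T) * d₃
      + (Module.finrank ℝ (fiberSpan₁ T) : ℝ) * Module.finrank ℝ (fiberSpan₃ T) * d₂
      + (Module.finrank ℝ (fiberSpan₂ T) : ℝ) * Module.finrank ℝ (fiberSpan₃ T) * d₁ := by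
  rw [rbar, Real.sq_sqrt (by positivity)]
  -- When d = 0 the quotient in `rbar` is 0 by convention, and the right side vanishes too.
  rcases eq_or_ne ((d₁ : ℝ) + d₂ + d₃) 0 with h | h
  · have p1 : (0 : ℝ) ≤ d₁ := d₁.cast_nonneg
    have p2 : (0 : ℝ) ≤ d₂ := d₂.cast_nonneg
    have p3 : (0 : ℝ) ≤ d₃ := d₃.cast_nonneg
    have h1 : (d₁ : ℝ) = 0 := by linarith
    have h2 : (d₂ : ℝ) = 0 := by linarith
    have h3 : (d₃ : ℝ) = 0 := by linarith
    simp [h1, h2, h3]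
  · rw [div_mul_cancel₀ _ h]

/-- Inserting the coherence bounds, each product of two cancels two of the three dimensions in N and
leaves μ₀²r_i r_j d_l. -/
theorem mul_sq_norm_QProj_single_le {μ₀ : ℝ} (hμ : coherence T ≤ μ₀) (w : Idx d₁ d₂ d₃) :
    (d₁ : ℝ) * d₂ * d₃ * ‖QProj T (EuclideanSpace.single w 1)‖ ^ 2
      ≤ μ₀ ^ 2 * rbar T ^ 2 * ((d₁ : ℝ) + d₂ + d₃) := by
  have h1 := sq_norm_starProjection_single_le _ ((le_max_left _ _).trans hμ) w.1
  have h2 := sq_norm_starProjection_single_le _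
    (((le_max_left _ _).trans (le_max_right _ _)).trans hμ) w.2.1
  have h3 := sq_norm_starProjection_single_le _
    (((le_max_right _ _).trans (le_max_right _ _)).trans hμ) w.2.2
  have hμ0 : 0 ≤ μ₀ := (subspaceCoherence_nonneg _).trans ((le_max_left _ _).trans hμ)
  have hd₁ : (0 : ℝ) < d₁ := by exact_mod_cast w.1.pos
  have hd₂ : (0 : ℝ) < d₂ := by exact_mod_cast w.2.1.pos
  have hd₃ : (0 : ℝ) < d₃ := by exact_mod_cast w.2.2.pos
  rw [mul_assoc (μ₀ ^ 2), sq_rbar_mul, ← inner_single_QProj_single]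
  calc (d₁ : ℝ) * d₂ * d₃ *
        inner ℝ (EuclideanSpace.single w 1) (QProj T (EuclideanSpace.single w 1))
      ≤ (d₁ : ℝ) * d₂ * d₃ *
        ((μ₀ * Module.finrank ℝ (fiberSpan₁ T) / d₁) * (μ₀ * Module.finrank ℝ (fiberSpan₂ T) / d₂)
        + (μ₀ * Module.finrank ℝ (fiberSpan₁ T) / d₁) * (μ₀ * Module.finrank ℝ (fiberSpan₃ T) / d₃)
        + (μ₀ * Module.finrank ℝ (fiberSpan₂ T) / d₂) *
          (μ₀ * Module.finrank ℝ (fiberSpan₃ T) / d₃)) := by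
        refine mul_le_mul_of_nonneg_left ((inner_single_QProj_single_le T w).trans ?_)
          (by positivity)
        gcongr
    _ = _ := by field_simp

/-- Summing over an index the squared projection lengths of the unit vectors gives r_j, while the
index absent from a product contributes its dimension. -/
theorem opTrace_QProj_le : opTrace (QProj T) ≤ rbar T ^ 2 * ((d₁ : ℝ) + d₂ + d₃) := by
  rw [sq_rbar_mul, opTrace_eq_sum_inner (EuclideanSpace.basisFun _ ℝ)]
  simp only [EuclideanSpace.basisFun_apply]
  refine (Finset.sum_le_sum fun w _ => inner_single_QProj_single_le T w).trans (le_of_eq ?_)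
  simp only [Finset.sum_add_distrib, Fintype.sum_prod_type, Finset.sum_const, Finset.card_univ,
    Fintype.card_fin, nsmul_eq_mul, ← Finset.mul_sum, ← Finset.sum_mul,
    sum_sq_norm_starProjection_single]
  ring

end Tensors

/-! ### Bernstein inequalities for uniform sampling -/

section Sampling

variable {Ω : Type*} [MeasurableSpace Ω] {P : Measure Ω} [IsProbabilityMeasure P]
  {W : Type*} [Fintype W] [MeasurableSpace W] [MeasurableSingletonClass W]

/-- Operator Bernstein inequality for uniform sampling of rank-one terms from a Parseval frame. -/
theorem measureReal_le_norm_sum_frame_le {E : Type*} [NormedAddCommGroup E]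
    [InnerProductSpace ℝ E] [FiniteDimensional ℝ E] [Nonempty W] {ι : Type*} {s : ι → Ω → W}
    (hs : ∀ i, Measurable (s i)) (hind : iIndepFun s P)
    (hp : ∀ i w, P.real (s i ⁻¹' {w}) = (Fintype.card W : ℝ)⁻¹)
    {f : W → E} (hf : ∀ x, ∑ w, inner ℝ (f w) x • f w = x) {M t : ℝ} (hM : 0 < M)
    (hfM : ∀ w, Fintype.card W * ‖f w‖ ^ 2 ≤ M) (ht : 0 < t) {B : Finset ι} (hB : 0 < B.card) :
    P.real {ω | t ≤ ‖∑ i ∈ B, (ContinuousLinearMap.id ℝ E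
        - (Fintype.card W : ℝ) • InnerProductSpace.rankOne ℝ (f (s i ω)) (f (s i ω)))‖}
      ≤ 2 * Module.finrank ℝ E * Real.exp (-((t ^ 2 / 2) / (B.card * M + 2 * M * t / 3))) := by
  set N : ℝ := (Fintype.card W : ℝ) with hNdef
  have hN : 0 < N := by rw [hNdef]; exact_mod_cast Fintype.card_pos
  have hsq : ∀ x, ∑ w, inner ℝ (f w) x ^ 2 = ‖x‖ ^ 2 := by
    intro x
    have h := congrArg (fun y => inner ℝ y x) (hf x)
    simpa [sum_inner, inner_smul_left, ← sq] using h
  have hsum : ∑ _w : W, N⁻¹ = 1 := by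
    rw [Finset.sum_const, Finset.card_univ, nsmul_eq_mul, mul_inv_cancel₀ hN.ne']
  -- This says M ≥ 1, in a form that also holds for E = 0: ‖x‖² is the mean of N⟨f_w, x⟩², and each
  -- of these is at most M‖x‖².
  have hxM : ∀ x : E, ‖x‖ ≤ M * ‖x‖ := by
    intro x
    rcases eq_or_ne x 0 with rfl | hx
    · simp
    have hx0 : 0 < ‖x‖ ^ 2 := by positivity
    have h : ‖x‖ ^ 2 ≤ M * ‖x‖ ^ 2 := by
      rw [← hsq x]
      calc ∑ w, inner ℝ (f w) x ^ 2 ≤ ∑ _w : W, N⁻¹ * (M * ‖x‖ ^ 2) := by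
            refine Finset.sum_le_sum fun w _ => ?_
            have h1 : inner ℝ (f w) x ^ 2 ≤ (‖f w‖ * ‖x‖) ^ 2 := by
              rw [sq_le_sq, abs_of_nonneg (by positivity : 0 ≤ ‖f w‖ * ‖x‖)]
              exact abs_real_inner_le_norm _ _
            rw [← div_eq_inv_mul, le_div_iff₀ hN]
            have h2 := mul_le_mul_of_nonneg_right (hfM w) hx0.le
            have h3 := mul_le_mul_of_nonneg_right h1 hN.le
            linarith
        _ = M * ∑ w, inner ℝ (f w) x ^ 2 := by
            rw [← Finset.sum_mul, hsum, one_mul, hsq]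
    have : 1 ≤ M := by
      by_contra! hlt
      have := mul_lt_mul_of_pos_right hlt hx0
      linarith
    exact le_mul_of_one_le_left (norm_nonneg _) this
  -- Here L = 2M, from 1 + M ≤ 2M on a nonzero space, and σ = M.
  refine measureReal_le_norm_sum_le hs hind hp hsum (fun _ => by positivity)
    (Z := fun w => ContinuousLinearMap.id ℝ E - N • InnerProductSpace.rankOne ℝ (f w) (f w))
    (fun w => ?_) (fun w => ?_) ?_ (fun v => ?_) (by positivity) hM ht hB
  · refine (IsSelfAdjoint.one (E →L[ℝ] E)).sub ((IsSelfAdjoint.all N).smul ?_)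
    rw [isSelfAdjoint_iff, ContinuousLinearMap.star_eq_adjoint, InnerProductSpace.adjoint_rankOne]
  · refine ContinuousLinearMap.opNorm_le_bound _ (by positivity) fun x => ?_
    have h1 : ‖N • inner ℝ (f w) x • f w‖ ≤ M * ‖x‖ := by
      rw [norm_smul, norm_smul, Real.norm_of_nonneg hN.le]
      have h2 := mul_le_mul_of_nonneg_right (norm_inner_le_norm (𝕜 := ℝ) (f w) x)
        (norm_nonneg (f w))
      have h3 := mul_le_mul_of_nonneg_left h2 hN.le
      have h4 := mul_le_mul_of_nonneg_right (hfM w) (norm_nonneg x)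
      linarith
    have h := (norm_sub_le x (N • inner ℝ (f w) x • f w)).trans (add_le_add (hxM x) h1)
    calc _ = ‖x - N • inner ℝ (f w) x • f w‖ := by simp
      _ ≤ M * ‖x‖ + M * ‖x‖ := h
      _ = _ := by ring
  · ext x
    simp only [sum_apply, smul_apply, sub_apply, InnerProductSpace.rankOne_apply, smul_sub,
      Finset.sum_sub_distrib, smul_smul, inv_mul_cancel₀ hN.ne', one_mul]
    rw [hf, ← Finset.sum_smul, hsum]
    simp
  -- Expanding the square and averaging gives ‖v‖² - 2‖v‖² plus a term of size at most M‖v‖².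
  · have e : ∀ w, N⁻¹ * ‖(ContinuousLinearMap.id ℝ E
        - N • InnerProductSpace.rankOne ℝ (f w) (f w)) v‖ ^ 2
        = N⁻¹ * ‖v‖ ^ 2 - 2 * inner ℝ (f w) v ^ 2 + N * ‖f w‖ ^ 2 * inner ℝ (f w) v ^ 2 := by
      intro w
      have : (ContinuousLinearMap.id ℝ E - N • InnerProductSpace.rankOne ℝ (f w) (f w)) v
          = v - (N * inner ℝ (f w) v) • f w := by simp [smul_smul]
      rw [this, norm_sub_sq_real, inner_smul_right, norm_smul, mul_pow, Real.norm_eq_abs, sq_abs,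
        real_inner_comm (f w) v]
      field_simp
    simp_rw [e]
    rw [Finset.sum_add_distrib, Finset.sum_sub_distrib, ← Finset.sum_mul, hsum, ← Finset.mul_sum,
      hsq, one_mul]
    have h : ∑ w, N * ‖f w‖ ^ 2 * inner ℝ (f w) v ^ 2 ≤ M * ‖v‖ ^ 2 := by
      rw [← hsq v, Finset.mul_sum]
      exact Finset.sum_le_sum fun w _ => mul_le_mul_of_nonneg_right (hfM w) (sq_nonneg _)
    have := sq_nonneg ‖v‖
    linarith

/-- The scalar Bernstein inequality for identically distributed summands. -/
theorem measureReal_le_abs_sum_le {ι : Type*} {s : ι → Ω → W}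
    (hs : ∀ i, Measurable (s i)) (hind : iIndepFun s P) {p : W → ℝ}
    (hp : ∀ i w, P.real (s i ⁻¹' {w}) = p w) (hp1 : ∑ w, p w = 1) (hp0 : ∀ w, 0 ≤ p w)
    {ζ : W → ℝ} {L σ t : ℝ} (hL : ∀ w, |ζ w| ≤ L) (hmean : ∑ w, p w * ζ w = 0)
    (hvar : ∑ w, p w * ζ w ^ 2 ≤ σ) (hL0 : 0 ≤ L) (hσ : 0 < σ) (ht : 0 < t) {B : Finset ι}
    (hB : 0 < B.card) :
    P.real {ω | t ≤ |∑ i ∈ B, ζ (s i ω)|}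
      ≤ 2 * Real.exp (-((t ^ 2 / 2) / (B.card * σ + L * t / 3))) := by
  -- Scalars act as multiples of the identity of the one-dimensional space ℝ, so the dimension
  -- factor is 1.
  have h := measureReal_le_norm_sum_le (E := ℝ) hs hind hp hp1 hp0
    (Z := fun w => ζ w • ContinuousLinearMap.id ℝ ℝ) (L := L) (σ := σ)
    (fun w => (IsSelfAdjoint.all (ζ w)).smul (IsSelfAdjoint.one (ℝ →L[ℝ] ℝ)))
    (fun w => by simpa [norm_smul] using hL w)
    (by simp_rw [smul_smul]; rw [← Finset.sum_smul, hmean, zero_smul])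
    (fun v => by
      simp only [smul_apply, ContinuousLinearMap.id_apply, norm_smul, mul_pow, Real.norm_eq_abs,
        sq_abs, ← mul_assoc, ← Finset.sum_mul]
      exact mul_le_mul_of_nonneg_right hvar (sq_nonneg v)) hL0 hσ ht hB
  simpa [← Finset.sum_smul, norm_smul] using h

end Sampling

/-! ### Compression to the range of a projection -/

section Compression

variable {F : Type*} [NormedAddCommGroup F] [InnerProductSpace ℝ F]

theorem mul_le_opNorm_of_le_opNorm_one_div_smul {A : F →L[ℝ] F} {m t : ℝ} (hm : 0 < m)
    (h : t ≤ ‖(1 / m) • A‖) : m * t ≤ ‖A‖ := by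
  rw [norm_smul, Real.norm_of_nonneg (by positivity), one_div, ← div_eq_inv_mul,
    le_div_iff₀ hm, mul_comm] at h
  exact h

variable [FiniteDimensional ℝ F]

/-- A self-adjoint idempotent is the orthogonal projection onto its range. -/
theorem exists_eq_starProjection {Q : F →L[ℝ] F} (hQ : IsSelfAdjoint Q) (hQ2 : Q * Q = Q) :
    ∃ K : Submodule ℝ F, Q = K.starProjection := by
  obtain ⟨K, _, h⟩ := isStarProjection_iff_eq_starProjection.1 ⟨hQ2, hQ⟩
  exact ⟨K, h⟩

/-- Passing to operators on K makes the dimension factor in Bernstein's inequality dim K instead of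
d₁d₂d₃. -/
theorem norm_starProjection_comp_comp_le (K : Submodule ℝ F) (R : F →L[ℝ] F) :
    ‖K.starProjection ∘L R ∘L K.starProjection‖
      ≤ ‖K.orthogonalProjectionOnto ∘L R ∘L K.subtypeL‖ := by
  refine ContinuousLinearMap.opNorm_le_bound _ (ContinuousLinearMap.opNorm_nonneg _) fun x => ?_
  have h := (K.orthogonalProjectionOnto ∘L R ∘L K.subtypeL).le_opNorm (K.orthogonalProjectionOnto x)
  refine le_trans (le_of_eq ?_) (h.trans (mul_le_mul_of_nonneg_left ?_
    (ContinuousLinearMap.opNorm_nonneg _)))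
  · rfl
  · exact K.norm_starProjection_apply_le x

end Compression

/-! ### Tail bounds for one block of samples -/

section SampledBlocks

variable {d₁ d₂ d₃ : ℕ}

theorem card_block {n n₁ k : ℕ} (hk : 1 ≤ k) (hkn : k * n₁ ≤ n) : (block n n₁ k).card = n₁ := by
  have e : (block n n₁ k).map Fin.valEmbedding = Finset.Ico ((k - 1) * n₁) (k * n₁) := by
    ext i
    simp only [block, Finset.mem_map, Finset.mem_filter, Finset.mem_univ, true_and,
      Fin.valEmbedding_apply, Finset.mem_Ico]
    constructor
    · rintro ⟨j, hj, rfl⟩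
      exact hj
    · exact fun h => ⟨⟨i, h.2.trans_le hkn⟩, h, rfl⟩
  rw [← Finset.card_map Fin.valEmbedding, e, Nat.card_Ico, ← Nat.sub_mul, Nat.sub_sub_self hk,
    one_mul]

/-- As the block has exactly n₁ positions, the identity can be shared out among the summands, which
makes each of them centred. -/
theorem RBlock_apply {n n₁ k : ℕ} (hn₁ : 0 < n₁) (hk : 1 ≤ k) (hkn : k * n₁ ≤ n)
    (x : Fin n → Idx d₁ d₂ d₃) (X : Tensor d₁ d₂ d₃) :
    RBlock x n₁ k X = (1 / (n₁ : ℝ)) • ∑ i ∈ block n n₁ k,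
      (X - ((d₁ : ℝ) * d₂ * d₃ * X (x i)) • EuclideanSpace.single (x i) (1 : ℝ)) := by
  have h0 : (n₁ : ℝ) ≠ 0 := by exact_mod_cast hn₁.ne'
  have e : ∀ w, entryProj w X = X w • EuclideanSpace.single w (1 : ℝ) := fun w => by
    change EuclideanSpace.single w (X w) = _
    ext v
    by_cases h : v = w <;> simp [h]
  rw [Finset.sum_sub_distrib, Finset.sum_const, card_block hk hkn, smul_sub,
    ← Nat.cast_smul_eq_nsmul ℝ, smul_smul, one_div_mul_cancel h0, one_smul]
  simp only [RBlock, sub_apply, ContinuousLinearMap.id_apply, smul_apply, sum_apply, e, smul_smul]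

theorem card_idx : (Fintype.card (Idx d₁ d₂ d₃) : ℝ) = (d₁ : ℝ) * d₂ * d₃ := by
  simp [mul_assoc]

theorem measureReal_preimage_singleton_of_iidUniform {Ω : Type*} [MeasurableSpace Ω] {P : Measure Ω}
    {n : ℕ} {s : Fin n → Ω → Idx d₁ d₂ d₃} (hs : IIDUniform P s) (i : Fin n)
    (w : Idx d₁ d₂ d₃) : P.real (s i ⁻¹' {w}) = (Fintype.card (Idx d₁ d₂ d₃) : ℝ)⁻¹ := by
  rw [measureReal_def, ← Measure.map_apply (hs.1 i) (measurableSet_singleton w), hs.2.2 i,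
    uniformOn_univ, Measure.count_singleton]
  simp

theorem abs_apply_le_maxNorm (X : Tensor d₁ d₂ d₃) (w : Idx d₁ d₂ d₃) : |X w| ≤ maxNorm X :=
  le_ciSup (f := fun w => |X w|) (Set.finite_range _).bddAbove w

theorem exists_le_abs_apply_of_le_maxNorm {X : Tensor d₁ d₂ d₃} {t : ℝ} (ht : 0 < t)
    (h : t ≤ maxNorm X) : ∃ w, t ≤ |X w| := by
  cases isEmpty_or_nonempty (Idx d₁ d₂ d₃)
  · rw [maxNorm, Real.iSup_of_isEmpty] at h
    exact absurd h (not_le.2 ht)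
  · obtain ⟨w, hw⟩ := exists_eq_ciSup_of_finite (f := fun w => |X w|)
    exact ⟨w, h.trans hw.ge⟩

variable {Ω : Type*} [MeasurableSpace Ω] {P : Measure Ω} [IsProbabilityMeasure P]

/-- The exponent for m summands with σ = M, L = 2M, at the deviation t = mτ of the unnormalised sum.
-/
theorem bernstein_exponent_eq {m M τ : ℝ} (hm : 0 < m) (hM : 0 < M) (hτ : 0 < τ) :
    ((m * τ) ^ 2 / 2) / (m * M + 2 * M * (m * τ) / 3)
      = (τ ^ 2 / 2) / (1 + 2 * τ / 3) * (m / M) := by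
  field_simp

/-- The projections of the unit tensors to K form a Parseval frame of K, and the compressed block is
an average of the frame terms. -/
theorem measureReal_le_norm_starProjection_comp_RBlock_le {n n₁ k : ℕ} (hn₁ : 0 < n₁)
    (hk : 1 ≤ k) (hkn : k * n₁ ≤ n) {s : Fin n → Ω → Idx d₁ d₂ d₃} (hs : IIDUniform P s)
    (K : Submodule ℝ (Tensor d₁ d₂ d₃)) {M τ : ℝ} (hM : 0 < M)
    (hKM : ∀ w, (d₁ : ℝ) * d₂ * d₃ * ‖K.starProjection (EuclideanSpace.single w 1)‖ ^ 2 ≤ M)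
    (hτ : 0 < τ) :
    P.real {ω | τ ≤ ‖K.starProjection ∘L RBlock (fun i => s i ω) n₁ k ∘L K.starProjection‖}
      ≤ 2 * Module.finrank ℝ K
        * Real.exp (-((τ ^ 2 / 2) / (1 + 2 * τ / 3) * ((n₁ : ℝ) / M))) := by
  have hn0 : (0 : ℝ) < n₁ := by exact_mod_cast hn₁
  have hcard := card_block hk hkn
  have hB : 0 < (block n n₁ k).card := by rw [hcard]; exact hn₁
  -- An outcome of a sample witnesses that no dimension is zero.
  obtain ⟨i₀, -⟩ := Finset.card_pos.1 hB
  obtain ⟨ω₀⟩ := nonempty_of_isProbabilityMeasure P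
  have : Nonempty (Idx d₁ d₂ d₃) := ⟨s i₀ ω₀⟩
  set f : Idx d₁ d₂ d₃ → K := fun w => K.orthogonalProjectionOnto (EuclideanSpace.single w 1)
  have hfx : ∀ w (x : K), inner ℝ (f w) x = (x : Tensor d₁ d₂ d₃) w := by
    intro w x
    calc inner ℝ (f w) x
        = inner ℝ (K.starProjection (EuclideanSpace.single w 1)) (x : Tensor d₁ d₂ d₃) := rfl
      _ = inner ℝ (EuclideanSpace.single w 1) (x : Tensor d₁ d₂ d₃) := by
        rw [Submodule.inner_starProjection_left_eq_right,
          Submodule.starProjection_eq_self_iff.2 x.2]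
      _ = _ := by simp [EuclideanSpace.inner_single_left]
  have hf : ∀ x : K, ∑ w, inner ℝ (f w) x • f w = x := by
    intro x
    simp only [hfx, f, ← map_smul, ← map_sum]
    have e : ∑ w, (x : Tensor d₁ d₂ d₃) w • EuclideanSpace.single w (1 : ℝ)
        = (x : Tensor d₁ d₂ d₃) := by
      have h := (EuclideanSpace.basisFun (Idx d₁ d₂ d₃) ℝ).sum_repr (x : Tensor d₁ d₂ d₃)
      simpa only [EuclideanSpace.basisFun_repr, EuclideanSpace.basisFun_apply] using h
    rw [e]
    exact K.orthogonalProjectionOnto_mem_subspace_eq_self x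
  have hbern := measureReal_le_norm_sum_frame_le (P := P) hs.1 hs.2.1
    (measureReal_preimage_singleton_of_iidUniform hs) hf hM (fun w => by rw [card_idx]; exact hKM w)
    (mul_pos hn0 hτ) hB
  rw [hcard, bernstein_exponent_eq hn0 hM hτ] at hbern
  refine (measureReal_mono fun ω hω => ?_).trans hbern
  have e : K.orthogonalProjectionOnto ∘L RBlock (fun i => s i ω) n₁ k ∘L K.subtypeL =
      (1 / (n₁ : ℝ)) • ∑ i ∈ block n n₁ k, (ContinuousLinearMap.id ℝ K
        - (Fintype.card (Idx d₁ d₂ d₃) : ℝ) •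
          InnerProductSpace.rankOne ℝ (f (s i ω)) (f (s i ω))) := by
    refine ContinuousLinearMap.ext fun y => ?_
    have hy : K.orthogonalProjectionOnto (y : Tensor d₁ d₂ d₃) = y :=
      K.orthogonalProjectionOnto_mem_subspace_eq_self y
    simp only [ContinuousLinearMap.comp_apply, Submodule.subtypeL_apply,
      RBlock_apply hn₁ hk hkn, map_smul, map_sum, map_sub, smul_apply, sum_apply, sub_apply,
      ContinuousLinearMap.id_apply, InnerProductSpace.rankOne_apply, hfx, smul_smul, card_idx, hy,
      f]
  have h1 := (show τ ≤ _ from hω).trans (norm_starProjection_comp_comp_le K _)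
  rw [e] at h1
  exact mul_le_opNorm_of_le_opNorm_one_div_smul hn0 h1

/-- With g = Q e_v, the entry is ⟨g, R X⟩, the average of the centred scalars ⟨g, X⟩ - N X_w g_w.
Scalar Bernstein applies with L = 2M and σ = M. -/
theorem measureReal_le_abs_RBlock_apply_le {n n₁ k : ℕ} (hn₁ : 0 < n₁)
    (hk : 1 ≤ k) (hkn : k * n₁ ≤ n) {s : Fin n → Ω → Idx d₁ d₂ d₃} (hs : IIDUniform P s)
    {Q : Tensor d₁ d₂ d₃ →L[ℝ] Tensor d₁ d₂ d₃} (hQ : IsSelfAdjoint Q) (hQ2 : Q * Q = Q)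
    {M τ : ℝ} (hM : 0 < M)
    (hQM : ∀ w, (d₁ : ℝ) * d₂ * d₃ * ‖Q (EuclideanSpace.single w 1)‖ ^ 2 ≤ M)
    (hτ : 0 < τ) {X : Tensor d₁ d₂ d₃} (hX : maxNorm X ≤ 1) (v : Idx d₁ d₂ d₃) :
    P.real {ω | τ ≤ |Q (RBlock (fun i => s i ω) n₁ k X) v|}
      ≤ 2 * Real.exp (-((τ ^ 2 / 2) / (1 + 2 * τ / 3) * ((n₁ : ℝ) / M))) := by
  have hn0 : (0 : ℝ) < n₁ := by exact_mod_cast hn₁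
  have hcard := card_block hk hkn
  have hB : 0 < (block n n₁ k).card := by rw [hcard]; exact hn₁
  set N : ℝ := (d₁ : ℝ) * d₂ * d₃ with hNdef
  have hN : 0 < N := by
    rw [hNdef, ← card_idx]
    exact_mod_cast Fintype.card_pos_iff.2 ⟨v⟩
  set g : Tensor d₁ d₂ d₃ := Q (EuclideanSpace.single v 1)
  have hQv : ∀ Y, Q Y v = inner ℝ g Y := by
    intro Y
    rw [hQ.inner_apply_left]
    simp [EuclideanSpace.inner_single_left]
  have hXw : ∀ w, |X w| ≤ 1 := fun w => (abs_apply_le_maxNorm X w).trans hX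
  -- As Q is a projection, g_w = ⟨Q e_w, Q e_v⟩; Cauchy-Schwarz and the inequality of means reduce
  -- to the diagonal bounds.
  have hg : ∀ w, N * |g w| ≤ M := by
    intro w
    have e : g w = inner ℝ (Q (EuclideanSpace.single w 1)) g := by
      rw [hQ.inner_apply_left, ← mul_apply_eq_comp, hQ2]
      simp [EuclideanSpace.inner_single_left, g]
    have h1 : |g w| ≤ ‖Q (EuclideanSpace.single w 1)‖ * ‖g‖ := by
      rw [e]; exact abs_real_inner_le_norm _ _
    have h2 := two_mul_le_add_sq ‖Q (EuclideanSpace.single w 1)‖ ‖g‖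
    have h3 : |g w| ≤ (‖Q (EuclideanSpace.single w 1)‖ ^ 2 + ‖g‖ ^ 2) / 2 := by linarith
    have h4 := mul_le_mul_of_nonneg_left h3 hN.le
    have h5 := hQM w
    have h6 := hQM v
    linarith
  have hinner : inner ℝ g X = ∑ w, X w * g w := by
    simp [PiLp.inner_apply]
  have hnormg : ∑ w, g w ^ 2 = ‖g‖ ^ 2 := by
    rw [EuclideanSpace.norm_sq_eq]; simp
  have hsum : ∑ _w : Idx d₁ d₂ d₃, N⁻¹ = 1 := by
    rw [Finset.sum_const, Finset.card_univ, nsmul_eq_mul, card_idx, mul_inv_cancel₀ hN.ne']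
  have hXg : ∀ w, |X w * g w| ≤ |g w| := fun w => by
    rw [abs_mul]
    exact mul_le_of_le_one_left (abs_nonneg _) (hXw w)
  -- The inner product is the mean of the N X_w g_w, each at most M in modulus.
  have hgX : |inner ℝ g X| ≤ M := by
    rw [hinner]
    calc |∑ w, X w * g w| ≤ ∑ w, |X w * g w| := Finset.abs_sum_le_sum_abs _ _
      _ ≤ ∑ _w : Idx d₁ d₂ d₃, N⁻¹ * M := by
        refine Finset.sum_le_sum fun w _ => (hXg w).trans ?_
        rw [← div_eq_inv_mul, le_div_iff₀ hN, mul_comm]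
        exact hg w
      _ = M := by rw [← Finset.sum_mul, hsum, one_mul]
  have hbern := measureReal_le_abs_sum_le (P := P) hs.1 hs.2.1 (p := fun _ => N⁻¹)
    (fun i w => by rw [measureReal_preimage_singleton_of_iidUniform hs, card_idx]) hsum
    (fun _ => by positivity) (ζ := fun w => inner ℝ g X - N * (X w * g w)) (L := 2 * M) (σ := M)
    (fun w => by
      have h := abs_sub (inner ℝ g X) (N * (X w * g w))
      rw [abs_mul N, abs_of_pos hN] at h
      have := mul_le_mul_of_nonneg_left (hXg w) hN.le
      linarith [hg w])
    (by
      simp only [mul_sub, Finset.sum_sub_distrib, ← Finset.sum_mul, hsum, ← mul_assoc,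
        inv_mul_cancel₀ hN.ne', one_mul, hinner, sub_self])
    (by
      -- The variance is at most N ∑ (X_w g_w)² ≤ N‖g‖² ≤ M, because |X_w| ≤ 1.
      have e : ∀ w, N⁻¹ * (inner ℝ g X - N * (X w * g w)) ^ 2
          = N⁻¹ * inner ℝ g X ^ 2 - 2 * inner ℝ g X * (X w * g w) + N * (X w * g w) ^ 2 := by
        intro w
        field_simp
        ring
      simp only [e]
      rw [Finset.sum_add_distrib, Finset.sum_sub_distrib, ← Finset.sum_mul, hsum, ← Finset.mul_sum,
        ← hinner, ← Finset.mul_sum, one_mul]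
      have h1 : ∑ w, (X w * g w) ^ 2 ≤ ‖g‖ ^ 2 := by
        rw [← hnormg]
        exact Finset.sum_le_sum fun w _ => sq_le_sq.2 (hXg w)
      have h2 := mul_le_mul_of_nonneg_left h1 hN.le
      have h3 := hQM v
      nlinarith [sq_nonneg (inner ℝ g X)])
    (by positivity) hM (mul_pos hn0 hτ) hB
  rw [hcard, bernstein_exponent_eq hn0 hM hτ] at hbern
  refine (measureReal_mono fun ω hω => ?_).trans hbern
  have e : Q (RBlock (fun i => s i ω) n₁ k X) v
      = (n₁ : ℝ)⁻¹ * ∑ i ∈ block n n₁ k, (inner ℝ g X - N * (X (s i ω) * g (s i ω))) := by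
    rw [hQv, RBlock_apply hn₁ hk hkn, inner_smul_right, inner_sum, one_div]
    congr 1
    refine Finset.sum_congr rfl fun i _ => ?_
    rw [inner_sub_right, inner_smul_right]
    simp [EuclideanSpace.inner_single_right, mul_assoc, hNdef]
  have h1 : τ ≤ |Q (RBlock (fun i => s i ω) n₁ k X) v| := hω
  rw [e, abs_mul, abs_of_pos (inv_pos.2 hn0), ← div_eq_inv_mul, le_div_iff₀ hn0, mul_comm] at h1
  exact h1

/-- A union bound over the d₁d₂d₃ entries. -/
theorem measureReal_le_maxNorm_RBlock_le {n n₁ k : ℕ} (hn₁ : 0 < n₁)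
    (hk : 1 ≤ k) (hkn : k * n₁ ≤ n) {s : Fin n → Ω → Idx d₁ d₂ d₃} (hs : IIDUniform P s)
    {Q : Tensor d₁ d₂ d₃ →L[ℝ] Tensor d₁ d₂ d₃} (hQ : IsSelfAdjoint Q) (hQ2 : Q * Q = Q)
    {M τ : ℝ} (hM : 0 < M)
    (hQM : ∀ w, (d₁ : ℝ) * d₂ * d₃ * ‖Q (EuclideanSpace.single w 1)‖ ^ 2 ≤ M)
    (hτ : 0 < τ) {X : Tensor d₁ d₂ d₃} (hX : maxNorm X ≤ 1) :
    P.real {ω | τ ≤ maxNorm (Q (RBlock (fun i => s i ω) n₁ k X))}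
      ≤ 2 * d₁ * d₂ * d₃ * Real.exp (-((τ ^ 2 / 2) / (1 + 2 * τ / 3) * ((n₁ : ℝ) / M))) := by
  have hsub : {ω | τ ≤ maxNorm (Q (RBlock (fun i => s i ω) n₁ k X))} ⊆
      ⋃ v, {ω | τ ≤ |Q (RBlock (fun i => s i ω) n₁ k X) v|} := fun ω hω =>
    Set.mem_iUnion.2 (exists_le_abs_apply_of_le_maxNorm hτ hω)
  refine (measureReal_mono (μ := P) hsub).trans ((measureReal_iUnion_fintype_le _).trans
    ((Finset.sum_le_sum fun v _ =>
      measureReal_le_abs_RBlock_apply_le hn₁ hk hkn hs hQ hQ2 hM hQM hτ hX v).trans (le_of_eq ?_)))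
  rw [Finset.sum_const, Finset.card_univ, nsmul_eq_mul, card_idx]
  ring

end SampledBlocks

/-! ### The concentration bounds for Q_T R_k -/

theorem lemma6 {Ω : Type*} [MeasurableSpace Ω] (P : Measure Ω) [IsProbabilityMeasure P]
    (d₁ d₂ d₃ n n₁ n₂ : ℕ) (hn₁ : 0 < n₁) (hn : n₁ * n₂ ≤ n)
    (s : Fin n → Ω → Idx d₁ d₂ d₃) (hs : IIDUniform P s)
    (T : Tensor d₁ d₂ d₃) (μ₀ r : ℝ) (hμ : coherence T ≤ μ₀) (hr : rbar T = r)
    (k : ℕ) (hk₁ : 1 ≤ k) (hk₂ : k ≤ n₂) (τ : ℝ) (hτ : 0 < τ) :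
    P.real {ω | τ ≤ ‖QProj T ∘L RBlock (fun i => s i ω) n₁ k ∘L QProj T‖}
        ≤ 2 * r ^ 2 * ((d₁ : ℝ) + (d₂ : ℝ) + (d₃ : ℝ)) *
          Real.exp (-((τ ^ 2 / 2) / (1 + 2 * τ / 3) *
            ((n₁ : ℝ) / (μ₀ ^ 2 * r ^ 2 * ((d₁ : ℝ) + (d₂ : ℝ) + (d₃ : ℝ))))))
    ∧ (∀ X : Tensor d₁ d₂ d₃, maxNorm X = 1 →
        P.real {ω | τ ≤ maxNorm (QProj T (RBlock (fun i => s i ω) n₁ k X))}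
          ≤ 2 * (d₁ : ℝ) * (d₂ : ℝ) * (d₃ : ℝ) *
            Real.exp (-((τ ^ 2 / 2) / (1 + 2 * τ / 3) *
              ((n₁ : ℝ) / (μ₀ ^ 2 * r ^ 2 * ((d₁ : ℝ) + (d₂ : ℝ) + (d₃ : ℝ)))))))
    ∧ (∀ X : Tensor d₁ d₂ d₃, maxNorm X = 1 → QProj T X = X →
        P.real {ω | τ ≤ maxNorm (QProj T (RBlock (fun i => s i ω) n₁ k (QProj T X)))}
          ≤ 2 * (d₁ : ℝ) * (d₂ : ℝ) * (d₃ : ℝ) *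
            Real.exp (-((τ ^ 2 / 2) / (1 + 2 * τ / 3) *
              ((n₁ : ℝ) / (μ₀ ^ 2 * r ^ 2 * ((d₁ : ℝ) + (d₂ : ℝ) + (d₃ : ℝ))))))) := by
  have hkn : k * n₁ ≤ n := (Nat.mul_le_mul_right n₁ hk₂).trans (by rwa [mul_comm] at hn)
  subst hr
  have hQ := isSelfAdjoint_QProj T
  have hQ2 := QProj_mul_self T
  have hQM := mul_sq_norm_QProj_single_le T hμ
  have htr := opTrace_QProj_le T
  have hM0 : 0 ≤ μ₀ ^ 2 * rbar T ^ 2 * ((d₁ : ℝ) + d₂ + d₃) := by positivity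
  -- The third bound is the second one after replacing Q_T X by X.
  suffices h : P.real {ω | τ ≤ ‖QProj T ∘L RBlock (fun i => s i ω) n₁ k ∘L QProj T‖}
        ≤ 2 * rbar T ^ 2 * ((d₁ : ℝ) + (d₂ : ℝ) + (d₃ : ℝ)) *
          Real.exp (-((τ ^ 2 / 2) / (1 + 2 * τ / 3) *
            ((n₁ : ℝ) / (μ₀ ^ 2 * rbar T ^ 2 * ((d₁ : ℝ) + (d₂ : ℝ) + (d₃ : ℝ))))))
    ∧ (∀ X : Tensor d₁ d₂ d₃, maxNorm X = 1 →
        P.real {ω | τ ≤ maxNorm (QProj T (RBlock (fun i => s i ω) n₁ k X))}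
          ≤ 2 * (d₁ : ℝ) * (d₂ : ℝ) * (d₃ : ℝ) *
            Real.exp (-((τ ^ 2 / 2) / (1 + 2 * τ / 3) *
              ((n₁ : ℝ) / (μ₀ ^ 2 * rbar T ^ 2 * ((d₁ : ℝ) + (d₂ : ℝ) + (d₃ : ℝ))))))) from
    ⟨h.1, h.2, fun X hX hQX => by rw [hQX]; exact h.2 X hX⟩
  -- If M = 0, the quotient n₁/M is only a convention, but the diagonal bound forces Q_T = 0 and, as
  -- τ > 0, the events are empty.
  rcases hM0.eq_or_lt with hM | hM
  · have hQ0 : QProj T = 0 := by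
      refine euclideanSpace_clm_ext fun w => ?_
      have hN : 0 < (d₁ : ℝ) * d₂ * d₃ := by
        rw [← card_idx]
        exact_mod_cast Fintype.card_pos_iff.2 ⟨w⟩
      have h := hQM w
      rw [← hM] at h
      have h0 : ‖QProj T (EuclideanSpace.single w 1)‖ ^ 2 ≤ 0 := by
        by_contra! hlt
        exact absurd h (not_le.2 (mul_pos hN hlt))
      simpa using h0.antisymm (sq_nonneg _)
    have hmax : maxNorm (0 : Tensor d₁ d₂ d₃) = 0 := by simp [maxNorm]
    rw [hQ0]
    constructor
    · simp only [ContinuousLinearMap.zero_comp, norm_zero, not_le.2 hτ]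
      simp only [Set.ofPred_false, measureReal_empty]
      positivity
    · intro X _
      simp only [zero_apply, hmax, not_le.2 hτ]
      simp only [Set.ofPred_false, measureReal_empty]
      positivity
  · refine ⟨?_, fun X hX => measureReal_le_maxNorm_RBlock_le hn₁ hk₁ hkn hs hQ hQ2 hM hQM hτ hX.le⟩
    -- The factor r²d enters here: dim K is the trace of Q_T.
    obtain ⟨K, hK⟩ := exists_eq_starProjection hQ hQ2
    rw [hK] at hQM htr ⊢
    refine (measureReal_le_norm_starProjection_comp_RBlock_le hn₁ hk₁ hkn hs K hM hQM hτ).trans ?_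
    rw [opTrace_starProjection] at htr
    refine mul_le_mul_of_nonneg_right ?_ (Real.exp_pos _).le
    linarith
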